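/- **Setting.** A cluster $\mathcal C$ of $C\ge 1$ secondary users, numbered $1,\dots,C$ in the order of successive interference cancellation, shares one primary channel of bandwidth $W>0$ and interference temperature threshold $\mathrm{ITC}>0$. In phase $s$ (time fraction $\lambda$) the secondary base station $s$ transmits to the UAV $r$; in phase $r$ (time fraction $1-\lambda$) the UAV transmits to the users. For a hop from $i$ to $j$, with $(i,j)=(s,r)$ or $(r,n)$, let $P_i$ and $P_p$ be the powers of $i$ and of the primary base station $p$ on the channel, $\ell_i^j,\ell_p^j,\ell_i^k>0$ the path attenuations from $i$ to $j$, from $p$ to $j$, and from $i$ to the primary user $k$, $\sigma^2_{\phi_i^j},\sigma^2_{\phi_p^j}\ge0$ the distortion powers, $\sigma^2_{e_i^j}\ge 0$ the channel error variance, $\sigma_j^2>0$ the thermal noise, and $$E=\sigma_{e_i^j}^2(1+\sigma_{\phi_i^j}^2),\qquad I_p(q)=\frac{P_p\ell_p^j}{q\,\ell_i^j}(1+\sigma_{\phi_p^j}^2),\qquad \bar\sigma^2(q)=\frac{\sigma_j^2}{q\,\ell_i^j}.$$ A message of user $n$ with power factors $v=(v^1,\dots,v^C)$ ($v=\alpha$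 in phase $s$, $v=\beta$ in phase $r$), transmitted at power $q$ with fading powers $X$ (of $i\to j$) and $Z$ (of $p\to j$), has SIDNR $$\gamma=\frac{Xv^n}{X\sum_{m>n}v^m+X\sigma_{\phi_i^j}^2+E+Z I_p(q)+\bar\sigma^2(q)} .$$ The rate of user $n$ is $R^n=\min\{\lambda W\log_2(1+\gamma_n^{s}),(1-\lambda)W\log_2(1+\gamma_n^{r})\}$. **Optimal allocation.** Fix a channel state with fading powers $\hat X,\hat Y>0$, $\hat Z\ge0$ for all links ($\hat Y_i$ for the link $i\to k$). Put $\Phi_i=\min\{1,\mathrm{ITC}/(P_i\ell_i^k\hat Y_i)\}$ and $I=\sigma_{\phi_i^j}^2+(E+\hat Z I_p(P_i)+\bar\sigma^2(P_i))/\hat X$, written $I_r$ for the hop $s\to r$ and $I_n$ for the hop $r\to n$. The power control problem is to maximize $\gamma\ge 0$ over $\alpha,\beta\in[0,1]^C$ with $\sum_n\alpha^n\le\Phi_s$, $\sum_n\beta^n\le\Phi_r$ and both SIDNRs of every user (in this state, at powers $P_s,P_r$) at least $\gamma$; among its solutions one of least total energy $\sum_n\alpha^n+\sum_n\beta^n$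 is taken. The phase-time problem is to maximize $\min_nR^n$ over $\lambda\in[0,1]$ for the resulting SIDNRs. **Random fading and coverage.** Now let the fading powers be random: $X\sim\mathrm{Gamma}(x,x)$, $Y\sim\mathrm{Gamma}(y,y)$, $Z\sim\mathrm{Gamma}(z,z)$ (shape, rate), with $x,y$ positive integers and $z>0$ depending on the link, the six links that enter the end-to-end SIDNR of a user being independent; station $i$ transmits at power $\min\{P_i,\mathrm{ITC}/(\ell_i^kY)\}$. For fixed $(\alpha,\beta,\lambda)$ and a target rate $\bar R>0$, the coverage probability of user $n$ is $\Pr[R^n\ge\bar R]$, and that of the cluster is the minimum of these over its members. The starred values $\wp^{\star n}$ and $\wp^\star$ are those at the optimal allocation $(\alpha^\star,\beta^\star,\lambda^\star)$. **Closed form.** For a hop, factor $v^n$ and threshold $\bar\gamma$ let $\mathcal A=v^n-\bar\gamma\sum_{m>n}v^m-\bar\gamma\sigma^2_{\phi_i^j}$. Put $F(\bar\gamma)=1$ if $\mathcal A\le0$. Otherwise, with $T=\mathrm{ITC}/\ell_i^k$, $\Lambda=T/P_i$, $\mathcal I=I_p(P_i)\bar\gamma/\mathcal A$, $\mathcal E=E\bar\gamma/\mathcal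 A$, $\mathcal S=\bar\sigma^2(P_i)\bar\gamma/\mathcal A$, $\mathcal V=\bar\sigma^2(T)\bar\gamma/\mathcal A$, $\mathcal U=I_p(T)\bar\gamma/\mathcal A$, $$\begin{aligned}F(\bar\gamma)={}&\frac{\gamma_{inc}(y,y\Lambda)}{\Gamma(y)}\Bigl[1-\frac{z^ze^{-x(\mathcal E+\mathcal S)}}{\Gamma(z)}\sum_{q=0}^{x-1}\frac{x^q}{q!}\sum_{l=0}^q\binom ql\frac{(\mathcal E+\mathcal S)^{q-l}\mathcal I^l\,\Gamma(z+l)}{(z+x\mathcal I)^{z+l}}\Bigr]+\frac{\Gamma(y,y\Lambda)}{\Gamma(y)}\\&-\frac{z^ze^{-\Lambda(y+x\mathcal V)}}{\Gamma(z)}\frac{y^ye^{-x\mathcal E}}{\mathcal U^z\Gamma(y)}\sum_{\kappa=0}^{x-1}\sum_{j=0}^{\kappa}\sum_{u=0}^{j}\sum_{p=0}^{y+j-1}\sum_{t=0}^p\frac{x^{\kappa-z-u}}{\kappa!}\binom \kappa j\mathcal E^{\kappa-j}\binom ju\mathcal V^{j-u}\frac{\Lambda^p}{p!}\binom pt\\&\quad\times(y+x\mathcal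 V)^{p+u-j-y+z}\;G^{2,1}_{1,2}\!\left(\frac{(z+x\Lambda\mathcal U)(y+x\mathcal V)}{x\,\mathcal U}\,\middle|\,{1-(z+u+t)\atop 0,\;-z+y-t+j-u}\right),\end{aligned}$$ where $\gamma_{inc}(\cdot,\cdot)$, $\Gamma(\cdot,\cdot)$ are the lower and upper incomplete gamma functions and $G$ is Meijer's function. Write $F_n^s$, $F_n^r$ for the two hops of user $n$, with $v=\alpha^\star$, resp. $v=\beta^\star$. **Statement.** The power control problem has a unique least-energy solution $(\alpha^\star,\beta^\star,\gamma^\star)$. It has $\gamma^\star>0$; both SIDNRs of every user equal $\gamma^\star$; for all $n$ $$\alpha^{\star n}=I_r\gamma^\star(1+\gamma^\star)^{C-n},\qquad \beta^{\star n}=I_n\gamma^\star+\gamma^{\star2}\sum_{j>n}I_j(1+\gamma^\star)^{j-n-1};$$ and $\gamma^\star=\min\{(\Phi_s/I_r+1)^{1/C}-1,\ \gamma_2\}$, where $\gamma_2>0$ is the SIDNR at which the second formula (with $\gamma_2$ for $\gamma^\star$) gives $\sum_n\beta^n=\Phi_r$; for $C=2$, $\gamma_2=\bigl(\sqrt{4I_2\Phi_r+(I_1+I_2)^2}-I_1-I_2\bigr)/(2I_2)$.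 The phase-time problem has the unique solution $\lambda^\star=\tfrac12$, and $R^{\star n}=R^\star=\tfrac W2\log_2(1+\gamma^\star)$ for every $n$. The max-min coverage probability of user $n$ is obtained by substituting this allocation into the closed form, $$\wp^{\star n}=\bigl(1-F_n^s(2^{2\bar R/W}-1)\bigr)\bigl(1-F_n^r(2^{2\bar R/W}-1)\bigr),$$ and that of the cluster is $\wp^\star=\min_{n}\wp^{\star n}$, the minimum of these closed-form values. -/

import Mathlib

open MeasureTheory ProbabilityTheory

noncomputable section

namespace NOMA

/-- Lower incomplete gamma function `∫₀ˣ t^(a-1) e^(-t) dt`. -/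
def lowerGamma (a x : ℝ) : ℝ := ∫ t in Set.Ioc 0 x, t ^ (a - 1) * Real.exp (-t)

/-- Upper incomplete gamma function `∫ₓ^∞ t^(a-1) e^(-t) dt`. -/
def upperGamma (a x : ℝ) : ℝ := ∫ t in Set.Ioi x, t ^ (a - 1) * Real.exp (-t)

/-- The Meijer function `G^{2,1}_{1,2}(w | a ; b₁, b₂)` for real parameters with
`-b₁, -b₂ < 1 - a` and `w > 0`: the Mellin-Barnes integral
`(1 / 2πi) ∫ Γ(b₁ + s) Γ(b₂ + s) Γ(1 - a - s) w^(-s) ds` over a vertical line that has the poles of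
`Γ(b₁ + s) Γ(b₂ + s)` on its left and those of `Γ(1 - a - s)` on its right (the value does not
depend on the line; the midpoint is taken).  It is real, since the integrand at the conjugate point
is the conjugate. -/
def meijerG2112 (a b₁ b₂ w : ℝ) : ℝ :=
  (mellinInv ((max (-b₁) (-b₂) + (1 - a)) / 2)
    (fun s : ℂ => Complex.Gamma (b₁ + s) * Complex.Gamma (b₂ + s) * Complex.Gamma (1 - a - s)) w).re

/-- Parameters of one hop: a transmitter `i` (SBS or UAV) serving a receiver `j` (UAV or SU) on the
channel of the primary user PU, in the presence of interference from the primary station PBS. -/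
structure Hop where
  /-- maximal transmit power of `i` on the channel -/
  power : ℝ
  /-- path attenuation factor from `i` to `j` -/
  loss : ℝ
  /-- path attenuation factor from `i` to PU -/
  lossPU : ℝ
  /-- transmit power of PBS on the channel -/
  pbsPower : ℝ
  /-- path attenuation factor from PBS to `j` -/
  pbsLoss : ℝ
  /-- distortion noise power of the link from `i` to `j` -/
  dist : ℝ
  /-- distortion noise power of the link from PBS to `j` -/
  pbsDist : ℝ
  /-- variance of the channel estimation error of the link from `i` to `j` -/
  errVar : ℝ
  /-- thermal noise power at `j` -/
  noise : ℝ
  /-- interference temperature threshold of PU -/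
  itc : ℝ
  /-- fading parameter of the link from `i` to `j` -/
  x : ℕ
  /-- fading parameter of the link from `i` to PU -/
  y : ℕ
  /-- fading parameter of the link from PBS to `j` -/
  z : ℝ

namespace Hop

variable (L : Hop)

/-- Power of the channel estimation error. -/
def errPower : ℝ := L.errVar * (1 + L.dist)

/-- Interference factor of PBS, normalized by the received power, when `i` transmits at power `q`. -/
def pbsInterference (q : ℝ) : ℝ := L.pbsPower * L.pbsLoss / (q * L.loss) * (1 + L.pbsDist)

/-- Normalized thermal noise when `i` transmits at power `q`. -/
def normNoise (q : ℝ) : ℝ := L.noise / (q * L.loss)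

/-- SIDNR of a message with power factor `v` and SIC interference `I`, when `i` transmits at
power `q`, the fading power of the link is `X` and that of the link from PBS to `j` is `Z`. -/
def sidnr (q X Z v I : ℝ) : ℝ :=
  X * v / (X * I + X * L.dist + L.errPower + Z * L.pbsInterference q + L.normNoise q)

/-- Interference plus noise term of the SIDNR at full power, relative to the fading power `X`. -/
def noiseTerm (X Z : ℝ) : ℝ :=
  L.dist + (L.errPower + Z * L.pbsInterference L.power + L.normNoise L.power) / X

/-- Transmit power under the interference temperature constraint, when the fading power of the link
from `i` to PU is `Y`. -/
def txPower (Y : ℝ) : ℝ := min L.power (L.itc / (L.lossPU * Y))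

/-- Budget for the sum of the power factors, when the fading power of the link from `i` to PU is
`Y`. -/
def budget (Y : ℝ) : ℝ := min 1 (L.itc / (L.power * (L.lossPU * Y)))

/-- The closed-form distribution function, at the threshold `g`, of the SIDNR of a message with power
factor `v` and SIC interference `I`. -/
def cdfClosed (v I g : ℝ) : ℝ :=
  let A := v - I * g - L.dist * g
  let T := L.itc / L.lossPU
  let lam := T / L.power
  let cI := L.pbsInterference L.power * g / A
  let cE := L.errPower * g / A
  let cS := L.normNoise L.power * g / A
  let cV := L.normNoise T * g / A
  let cU := L.pbsInterference T * g / A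
  let x : ℝ := L.x
  let y : ℝ := L.y
  let z : ℝ := L.z
  if A ≤ 0 then 1 else
    lowerGamma y (y * lam) / Real.Gamma y
    - lowerGamma y (y * lam) / Real.Gamma y * (z ^ z * Real.exp (-x * (cE + cS)) / Real.Gamma z)
      * ∑ q ∈ Finset.range L.x, x ^ q / (q.factorial : ℝ)
        * ∑ l ∈ Finset.range (q + 1), (q.choose l : ℝ)
          * ((cE + cS) ^ (q - l) * cI ^ l * Real.Gamma (z + l) / (z + x * cI) ^ (z + l))
    + upperGamma y (y * lam) / Real.Gamma y
    - z ^ z * Real.exp (-lam * (y + x * cV)) / Real.Gamma z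
      * (y ^ y * Real.exp (-x * cE) / (cU ^ z * Real.Gamma y))
      * ∑ k ∈ Finset.range L.x, ∑ j ∈ Finset.range (k + 1), ∑ u ∈ Finset.range (j + 1),
        ∑ p ∈ Finset.range (L.y + j), ∑ t ∈ Finset.range (p + 1),
          x ^ ((k : ℝ) - z - u) / (k.factorial : ℝ)
          * (k.choose j : ℝ) * cE ^ (k - j)
          * (j.choose u : ℝ) * cV ^ (j - u)
          * (lam ^ p / (p.factorial : ℝ))
          * (p.choose t : ℝ) * (y + x * cV) ^ ((p : ℝ) + u - j - y + z)
          * meijerG2112 (1 - (z + u + t)) 0 (-z + y - t + j - u)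
              ((z + x * lam * cU) * (y + x * cV) / (x * cU))

end Hop

/-- A cluster of `C` secondary users, indexed in the order of successive interference cancellation,
on one primary channel.  Letters: `S` secondary base station, `R` UAV, `P` primary base station,
`N` secondary users, `K` primary user; e.g. `lossSR` belongs to the link from `S` to `R`. -/
structure Network (C : ℕ) where
  bandwidth : ℝ
  itc : ℝ
  powerS : ℝ
  powerR : ℝ
  powerP : ℝ
  lossSR : ℝ
  lossSK : ℝ
  lossPR : ℝ
  lossRK : ℝ
  lossRN : Fin C → ℝ
  lossPN : Fin C → ℝ
  distSR : ℝ
  distPR : ℝ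
  distRN : Fin C → ℝ
  distPN : Fin C → ℝ
  errVarSR : ℝ
  errVarRN : Fin C → ℝ
  noiseR : ℝ
  noiseN : Fin C → ℝ
  /-- fading parameters -/
  mSR : ℕ
  mSK : ℕ
  mPR : ℝ
  mRN : Fin C → ℕ
  mRK : ℕ
  mPN : Fin C → ℝ

/-- Fading powers (squared moduli of the small-scale fading coefficients) of all links; for the
links `SR` and `RN` those of the estimated coefficients. -/
structure Gains (C : ℕ) where
  SR : ℝ
  SK : ℝ
  PR : ℝ
  RN : Fin C → ℝ
  RK : ℝ
  PN : Fin C → ℝ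

/-- A channel state with positive gains (the interference gains from the primary
base station may vanish). -/
structure Gains.Valid {C : ℕ} (h : Gains C) : Prop where
  SR : 0 < h.SR
  SK : 0 < h.SK
  PR : 0 ≤ h.PR
  RN : ∀ n, 0 < h.RN n
  RK : 0 < h.RK
  PN : ∀ n, 0 ≤ h.PN n

namespace Network

variable {C : ℕ} (net : Network C)

/-- Physically meaningful parameters. -/
structure Valid : Prop where
  bandwidth : 0 < net.bandwidth
  itc : 0 < net.itc
  powerS : 0 < net.powerS
  powerR : 0 < net.powerR
  powerP : 0 < net.powerP
  lossSR : 0 < net.lossSR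
  lossSK : 0 < net.lossSK
  lossPR : 0 < net.lossPR
  lossRK : 0 < net.lossRK
  lossRN : ∀ n, 0 < net.lossRN n
  lossPN : ∀ n, 0 < net.lossPN n
  distSR : 0 ≤ net.distSR
  distPR : 0 ≤ net.distPR
  distRN : ∀ n, 0 ≤ net.distRN n
  distPN : ∀ n, 0 ≤ net.distPN n
  errVarSR : 0 ≤ net.errVarSR
  errVarRN : ∀ n, 0 ≤ net.errVarRN n
  noiseR : 0 < net.noiseR
  noiseN : ∀ n, 0 < net.noiseN n
  mSR : 0 < net.mSR
  mSK : 0 < net.mSK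
  mPR : 0 < net.mPR
  mRN : ∀ n, 0 < net.mRN n
  mRK : 0 < net.mRK
  mPN : ∀ n, 0 < net.mPN n

/-- The broadcasting hop, from the secondary base station to the UAV. -/
def hopS : Hop where
  power := net.powerS
  loss := net.lossSR
  lossPU := net.lossSK
  pbsPower := net.powerP
  pbsLoss := net.lossPR
  dist := net.distSR
  pbsDist := net.distPR
  errVar := net.errVarSR
  noise := net.noiseR
  itc := net.itc
  x := net.mSR
  y := net.mSK
  z := net.mPR

/-- The relaying hop, from the UAV to user `n`. -/
def hopR (n : Fin C) : Hop where
  power := net.powerR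
  loss := net.lossRN n
  lossPU := net.lossRK
  pbsPower := net.powerP
  pbsLoss := net.lossPN n
  dist := net.distRN n
  pbsDist := net.distPN n
  errVar := net.errVarRN n
  noise := net.noiseN n
  itc := net.itc
  x := net.mRN n
  y := net.mRK
  z := net.mPN n

/-- SIC interference on the message of user `n`: the power factors of the later users. -/
def sic (v : Fin C → ℝ) (n : Fin C) : ℝ := ∑ j ∈ Finset.Ioi n, v j

/-- First-phase SIDNR of user `n` when the secondary base station transmits at power `q`. -/
def sidnrS (q : ℝ) (h : Gains C) (α : Fin C → ℝ) (n : Fin C) : ℝ :=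
  net.hopS.sidnr q h.SR h.PR (α n) (sic α n)

/-- Second-phase SIDNR of user `n` when the UAV transmits at power `q`. -/
def sidnrR (q : ℝ) (h : Gains C) (β : Fin C → ℝ) (n : Fin C) : ℝ :=
  (net.hopR n).sidnr q (h.RN n) (h.PN n) (β n) (sic β n)

/-- End-to-end rate for phase-time factor `lam` and SIDNRs `gS`, `gR` of the two phases. -/
def rate (lam gS gR : ℝ) : ℝ :=
  min (lam * net.bandwidth * Real.logb 2 (1 + gS))
    ((1 - lam) * net.bandwidth * Real.logb 2 (1 + gR))

/-! ### Resource allocation in a given channel state `h` -/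

/-- Budgets of the power factors of the two phases. -/
def budgetS (h : Gains C) : ℝ := net.hopS.budget h.SK

def budgetR (h : Gains C) : ℝ := min 1 (net.itc / (net.powerR * (net.lossRK * h.RK)))

/-- Feasibility for the power control problem: `g` is a common lower bound of the end-to-end
SIDNRs. -/
structure Feasible (h : Gains C) (α β : Fin C → ℝ) (g : ℝ) : Prop where
  sidnr : ∀ n, g ≤ min (net.sidnrS net.powerS h α n) (net.sidnrR net.powerR h β n)
  sumS : ∑ n, α n ≤ net.budgetS h
  sumR : ∑ n, β n ≤ net.budgetR h
  memS : ∀ n, α n ∈ Set.Icc (0 : ℝ) 1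
  memR : ∀ n, β n ∈ Set.Icc (0 : ℝ) 1
  nonneg : 0 ≤ g

/-- `(α, β, g)` solves the power control problem: `g` is the largest feasible value, and among the
points that attain it `(α, β)` has the least total energy. -/
structure IsOptimalPower (h : Gains C) (α β : Fin C → ℝ) (g : ℝ) : Prop where
  feasible : net.Feasible h α β g
  max_min : ∀ α' β' g', net.Feasible h α' β' g' → g' ≤ g
  least_energy : ∀ α' β', net.Feasible h α' β' g →
    ∑ n, α n + ∑ n, β n ≤ ∑ n, α' n + ∑ n, β' n

/-- Rate of user `n` in the channel state `h`, for given allocations. -/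
def userRate (h : Gains C) (α β : Fin C → ℝ) (lam : ℝ) (n : Fin C) : ℝ :=
  net.rate lam (net.sidnrS net.powerS h α n) (net.sidnrR net.powerR h β n)

/-- Rate of the cluster: the minimum over its (finitely many) members. -/
def clusterRate (h : Gains C) (α β : Fin C → ℝ) (lam : ℝ) : ℝ :=
  ⨅ n, net.userRate h α β lam n

/-- `lam` solves the phase-time allocation problem for the SIDNRs produced by `(α, β)`. -/
def IsOptimalTime (h : Gains C) (α β : Fin C → ℝ) (lam : ℝ) : Prop :=
  lam ∈ Set.Icc (0 : ℝ) 1 ∧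
    ∀ lam' ∈ Set.Icc (0 : ℝ) 1, net.clusterRate h α β lam' ≤ net.clusterRate h α β lam

/-- Interference plus noise terms of the two phases. -/
def noiseS (h : Gains C) : ℝ := net.hopS.noiseTerm h.SR h.PR

def noiseTermR (h : Gains C) (n : Fin C) : ℝ := (net.hopR n).noiseTerm (h.RN n) (h.PN n)

/-- Closed-form power factors that give every user the SIDNR `g`. -/
def alphaClosed (h : Gains C) (g : ℝ) (n : Fin C) : ℝ :=
  net.noiseS h * g * (1 + g) ^ (C - 1 - (n : ℕ))

def betaClosed (h : Gains C) (g : ℝ) (n : Fin C) : ℝ :=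
  net.noiseTermR h n * g
    + g ^ 2 * ∑ j ∈ Finset.Ioi n, net.noiseTermR h j * (1 + g) ^ ((j : ℕ) - (n : ℕ) - 1)

/-! ### Coverage under random fading -/

variable {Ω : Type*} [MeasurableSpace Ω]

/-- Independent Nakagami fading: the fading powers are Gamma distributed with mean one, and for
every user the six links that enter its end-to-end SIDNR are independent. -/
structure IsNakagami (H : Ω → Gains C) (μ : Measure Ω) : Prop where
  lawSR : HasLaw (fun ω => (H ω).SR) (gammaMeasure net.mSR net.mSR) μ
  lawSK : HasLaw (fun ω => (H ω).SK) (gammaMeasure net.mSK net.mSK) μ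
  lawPR : HasLaw (fun ω => (H ω).PR) (gammaMeasure net.mPR net.mPR) μ
  lawRN : ∀ n, HasLaw (fun ω => (H ω).RN n) (gammaMeasure (net.mRN n) (net.mRN n)) μ
  lawRK : HasLaw (fun ω => (H ω).RK) (gammaMeasure net.mRK net.mRK) μ
  lawPN : ∀ n, HasLaw (fun ω => (H ω).PN n) (gammaMeasure (net.mPN n) (net.mPN n)) μ
  indep : ∀ n, iIndepFun (![fun ω => (H ω).SR, fun ω => (H ω).SK, fun ω => (H ω).PR,
    fun ω => (H ω).RN n, fun ω => (H ω).RK, fun ω => (H ω).PN n] : Fin 6 → Ω → ℝ) μ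

/-- Rate of user `n` under random fading, the transmit powers being limited by the interference
temperature constraint. -/
def fadingRate (h : Gains C) (α β : Fin C → ℝ) (lam : ℝ) (n : Fin C) : ℝ :=
  net.rate lam (net.sidnrS (net.hopS.txPower h.SK) h α n)
    (net.sidnrR ((net.hopR n).txPower h.RK) h β n)

/-- Coverage probability of user `n`: the rate is no less than `Rbar`. -/
def coverage (H : Ω → Gains C) (μ : Measure Ω) (Rbar : ℝ) (α β : Fin C → ℝ) (lam : ℝ)
    (n : Fin C) : ℝ :=
  μ.real {ω | Rbar ≤ net.fadingRate (H ω) α β lam n}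

/-- Coverage probability of the cluster: the minimum over its (finitely many) members. -/
def clusterCoverage (H : Ω → Gains C) (μ : Measure Ω) (Rbar : ℝ) (α β : Fin C → ℝ)
    (lam : ℝ) : ℝ :=
  ⨅ n, net.coverage H μ Rbar α β lam n

/-- SIDNR thresholds of the two phases for the rate threshold `Rbar`. -/
def thresholdS (Rbar lam : ℝ) : ℝ := (2 : ℝ) ^ (Rbar / (lam * net.bandwidth)) - 1

def thresholdR (Rbar lam : ℝ) : ℝ := (2 : ℝ) ^ (Rbar / ((1 - lam) * net.bandwidth)) - 1

/-- The closed-form coverage probability of user `n`. -/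
def coverageClosed (Rbar : ℝ) (α β : Fin C → ℝ) (lam : ℝ) (n : Fin C) : ℝ :=
  (1 - net.hopS.cdfClosed (α n) (sic α n) (net.thresholdS Rbar lam))
    * (1 - (net.hopR n).cdfClosed (β n) (sic β n) (net.thresholdR Rbar lam))

end Network

end NOMA

end

namespace NOMA
open Set Filter Topology

/-! Power control. At full power the SIDNR of user `n` is `v n / (sic v n + I n)`, so requiring it
to be at least `g` is a triangular system of linear inequalities: each factor is bounded below in
terms of the factors of later users. Induction from the last user shows that every feasible vector
dominates componentwise the vector that meets the constraints with equality (`le_of_sic_le`), and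
geometric sums put the latter in closed form (`alphaClosed_eq`, `betaClosed_eq`). Its total is
strictly increasing in `g`, so the optimal `g` is the one at which the first of the two budgets is
exhausted, and domination makes the least-energy solution unique. All SIDNRs are then equal, so
every rate is proportional to `min lam (1 - lam)`, which peaks only at `1 / 2`.

Coverage. Up to a null set, coverage means that both hops exceed their thresholds; they depend on
disjoint triples of independent gains, so the probability is a product. In one hop the condition is
linear in `X`. Given `Y` and `Z`, its probability is an Erlang survival function whose argument is
affine in `Z` below the power cutoff, and affine in `Y` with a slope affine in `Z` above it.
Binomial expansion (`erlangTail_add_mul`) reduces the averages over `Y` and then `Z` to gamma-type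
integrals.

Integrating `Y` beyond the cutoff leaves negative powers of an affine function of `Z`; their gamma
moments are integrals of `w^(s-1) e^(-θw) (1+w)^(-ρ)`. By `meijerG2112_eq_integral` these are Meijer
functions: two of the three Gamma factors form a Beta integral, Fubini exchanges the integrals, and
the inverse Mellin transform of the remaining Gamma is the exponential. -/

/-- `f` is integrable with integral `c`. -/
structure HasInt {α E : Type*} [MeasurableSpace α] [NormedAddCommGroup E] [NormedSpace ℝ E]
    (μ : Measure α) (f : α → E) (c : E) : Prop where
  integrable : Integrable f μ
  integral_eq : ∫ a, f a ∂μ = c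

/-! ### Mellin-Barnes integrals and the Meijer function -/

/-- The substitution `w = x / (1 - x)` carries the Beta integral from `(0, 1)` to the half-line. -/
lemma hasInt_beta {u v : ℂ} (hu : 0 < u.re) (hv : 0 < v.re) :
    HasInt (volume.restrict (Ioi (0 : ℝ)))
      (fun w : ℝ => (w : ℂ) ^ (u - 1) * ((1 + w : ℝ) : ℂ) ^ (-(u + v))) (Complex.betaIntegral u v) := by
  set g : ℝ → ℂ := fun w : ℝ => (w : ℂ) ^ (u - 1) * ((1 + w : ℝ) : ℂ) ^ (-(u + v)) with hg
  set f : ℝ → ℝ := fun x => x / (1 - x) with hf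
  have hderiv : ∀ x ∈ Ioo (0 : ℝ) 1, HasDerivWithinAt f (1 / (1 - x) ^ 2) (Ioo 0 1) x := by
    intro x hx
    have h1 : (1 : ℝ) - x ≠ 0 := by linarith [hx.2]
    have := (hasDerivAt_id x).div ((hasDerivAt_id x).const_sub 1) h1
    convert! this.hasDerivWithinAt using 1
    simp
  have hinj : InjOn f (Ioo 0 1) := by
    intro x hx y hy hxy
    have h1 : (1 : ℝ) - x ≠ 0 := by linarith [hx.2]
    have h2 : (1 : ℝ) - y ≠ 0 := by linarith [hy.2]
    simp only [hf] at hxy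
    rw [div_eq_div_iff h1 h2] at hxy
    linarith
  have himg : f '' Ioo 0 1 = Ioi 0 := by
    ext w
    constructor
    · rintro ⟨x, hx, rfl⟩
      exact div_pos hx.1 (by linarith [hx.2])
    · intro hw
      have hw : 0 < w := hw
      refine ⟨w / (1 + w), ⟨by positivity, by rw [div_lt_one (by positivity)]; linarith⟩, ?_⟩
      simp only [hf]
      field_simp
      ring
  have key : ∀ x ∈ Ioo (0 : ℝ) 1, |1 / (1 - x) ^ 2| • g (f x)
      = (x : ℂ) ^ (u - 1) * (1 - (x : ℂ)) ^ (v - 1) := by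
    intro x hx
    have h1 : 0 < 1 - x := by linarith [hx.2]
    have h1c : ((1 - x : ℝ) : ℂ) ≠ 0 := by exact_mod_cast h1.ne'
    have e1 : 1 + f x = (1 - x)⁻¹ := by simp only [hf]; field_simp; ring
    simp only [hg]
    rw [e1, abs_of_pos (by positivity)]
    simp only [hf, Complex.real_smul]
    -- A positive real has argument `0 ≠ π`, so complex powers are compatible with its inverse.
    have e2 : ((x / (1 - x) : ℝ) : ℂ) ^ (u - 1) = (x : ℂ) ^ (u - 1) * ((1 - x : ℝ) : ℂ) ^ (-(u - 1)) := by
      rw [div_eq_mul_inv, Complex.ofReal_mul, Complex.mul_cpow_ofReal_nonneg hx.1.le (by positivity),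
        Complex.ofReal_inv, Complex.inv_cpow, Complex.cpow_neg]
      rw [Complex.arg_ofReal_of_nonneg h1.le]; exact Real.pi_pos.ne
    have e3 : (((1 - x)⁻¹ : ℝ) : ℂ) ^ (-(u + v)) = ((1 - x : ℝ) : ℂ) ^ (u + v) := by
      rw [Complex.ofReal_inv, Complex.inv_cpow, Complex.cpow_neg, inv_inv]
      rw [Complex.arg_ofReal_of_nonneg h1.le]; exact Real.pi_pos.ne
    have e4 : ((1 / (1 - x) ^ 2 : ℝ) : ℂ) = ((1 - x : ℝ) : ℂ) ^ (-2 : ℂ) := by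
      rw [Complex.cpow_neg]; push_cast; norm_num [Complex.cpow_ofNat]
    rw [e2, e3, e4]
    have e5 : (1 - (x : ℂ)) ^ (v - 1) = ((1 - x : ℝ) : ℂ) ^ (-2 + (-(u - 1)) + (u + v)) := by
      push_cast; ring_nf
    rw [e5, Complex.cpow_add (-2 + -(u - 1)) (u + v) h1c, Complex.cpow_add (-2) (-(u - 1)) h1c]
    ring
  have hbeta := Complex.betaIntegral_convergent hu hv
  rw [intervalIntegrable_iff_integrableOn_Ioo_of_le zero_le_one] at hbeta
  constructor
  · change IntegrableOn g (Ioi 0)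
    rw [← himg, integrableOn_image_iff_integrableOn_abs_deriv_smul measurableSet_Ioo hderiv hinj]
    exact hbeta.congr_fun (fun x hx => (key x hx).symm) measurableSet_Ioo
  · rw [← himg, integral_image_eq_integral_abs_deriv_smul measurableSet_Ioo hderiv hinj,
      setIntegral_congr_fun measurableSet_Ioo key, Complex.betaIntegral,
      intervalIntegral.integral_of_le zero_le_one, integral_Ioc_eq_integral_Ioo]

lemma continuous_Gamma_vertical {σ : ℝ} (hσ : 0 < σ) :
    Continuous (fun t : ℝ => Complex.Gamma (σ + t * Complex.I)) := by
  rw [continuous_iff_continuousAt]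
  intro t
  have h : ContinuousAt Complex.Gamma (σ + t * Complex.I) := by
    refine (Complex.differentiableAt_Gamma _ fun m hm => ?_).continuousAt
    have := congrArg Complex.re hm
    simp at this
    have h2 : (0 : ℝ) ≤ m := m.cast_nonneg
    linarith
  exact ContinuousAt.comp (f := fun t : ℝ => (σ : ℂ) + t * Complex.I) h (by fun_prop)

lemma norm_Gamma_le {s : ℂ} (hs : 0 < s.re) : ‖Complex.Gamma s‖ ≤ Real.Gamma s.re := by
  rw [Complex.Gamma_eq_integral hs, Complex.GammaIntegral, Real.Gamma_eq_integral hs]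
  refine (norm_integral_le_integral_norm _).trans_eq ?_
  refine setIntegral_congr_fun measurableSet_Ioi fun x hx => ?_
  have hx : 0 < x := hx
  simp only [norm_mul, Complex.norm_real]
  rw [Complex.norm_cpow_eq_rpow_re_of_pos hx]
  simp [abs_of_pos (Real.exp_pos _)]

/-- Two uses of the recurrence give `Γ(s + 2) = (s + 1) s Γ(s)`. The left side is bounded on the
line by `Γ(σ + 2)` and `|s| ≤ |s + 1|`, so `Γ(s)` decays at least like `1 / |s|²`. -/
lemma integrable_Gamma_vertical {σ : ℝ} (hσ : 0 < σ) :
    Integrable (fun t : ℝ => Complex.Gamma (σ + t * Complex.I)) := by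
  have hb : Integrable (fun t : ℝ => Real.Gamma (σ + 2) * (σ ^ 2 + t ^ 2)⁻¹) := by
    refine Integrable.const_mul ?_ _
    have := (integrable_inv_one_add_sq.comp_div hσ.ne').const_mul (σ ^ 2)⁻¹
    refine this.congr (ae_of_all _ fun t => ?_)
    simp only
    field_simp
  refine hb.mono' (continuous_Gamma_vertical hσ).aestronglyMeasurable (ae_of_all _ fun t => ?_)
  set s : ℂ := σ + t * Complex.I with hs
  have hre : s.re = σ := by simp [hs]
  have him : s.im = t := by simp [hs]
  have h0 : s ≠ 0 := fun h => by rw [h] at hre; simp at hre; linarith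
  have h1 : s + 1 ≠ 0 := fun h => by
    have := congrArg Complex.re h; simp [hre] at this; linarith
  have hG : Complex.Gamma (s + 1 + 1) = (s + 1) * (s * Complex.Gamma s) := by
    rw [Complex.Gamma_add_one _ h1, Complex.Gamma_add_one _ h0]
  have hle : ‖Complex.Gamma (s + 1 + 1)‖ ≤ Real.Gamma (σ + 2) := by
    refine (norm_Gamma_le (by simp [hre]; linarith)).trans_eq ?_
    congr 1; simp [hre]; ring
  rw [hG, norm_mul, norm_mul] at hle
  have hn : ‖s‖ ^ 2 = σ ^ 2 + t ^ 2 := by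
    rw [← Complex.normSq_eq_norm_sq, Complex.normSq_apply, hre, him]; ring
  have hn1 : ‖s‖ ≤ ‖s + 1‖ := by
    refine le_of_sq_le_sq ?_ (norm_nonneg _)
    rw [hn, ← Complex.normSq_eq_norm_sq, Complex.normSq_apply]
    simp [hre, him]; nlinarith
  rw [← hn, ← div_eq_mul_inv, le_div_iff₀ (by have := norm_pos_iff.2 h0; positivity)]
  refine le_trans ?_ hle
  have := mul_le_mul_of_nonneg_right hn1 (mul_nonneg (norm_nonneg s) (norm_nonneg (Complex.Gamma s)))
  nlinarith

/-- `Γ` is the Mellin transform of `e^(-x)`; Mellin inversion applies because `Γ` is integrable on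
the vertical line. -/
lemma mellinInv_Gamma {σ x : ℝ} (hσ : 0 < σ) (hx : 0 < x) :
    mellinInv σ Complex.Gamma x = Complex.exp (-x) := by
  have hm : ∀ t : ℝ, mellin (fun x : ℝ => ((Real.exp (-x) : ℝ) : ℂ)) (σ + t * Complex.I)
      = Complex.Gamma (σ + t * Complex.I) := by
    intro t
    rw [Complex.Gamma_eq_integral (by simpa using hσ), Complex.GammaIntegral_eq_mellin]
  have := mellinInv_mellin_eq σ (fun x : ℝ => ((Real.exp (-x) : ℝ) : ℂ)) hx ?_ ?_ ?_
  · simp only [mellinInv] at this ⊢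
    simp_rw [hm] at this
    rw [this]; push_cast; rfl
  · have := Complex.GammaIntegral_convergent (s := σ) (by simpa using hσ)
    refine this.congr_fun (fun x _ => ?_) measurableSet_Ioi
    simp [mul_comm]
  · unfold Complex.VerticalIntegrable
    simp_rw [hm]
    exact integrable_Gamma_vertical hσ
  · fun_prop

/-- Supplies the factor in `w` of the dominating function for Fubini in `meijerG2112_eq_integral`.
-/
lemma integrableOn_beta {a b : ℝ} (ha : 0 < a) (hb : 0 < b) :
    IntegrableOn (fun w : ℝ => w ^ (a - 1) * (1 + w) ^ (-(a + b))) (Ioi 0) := by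
  have h := (hasInt_beta (u := a) (v := b) (by simpa using ha) (by simpa using hb)).integrable.re
  refine IntegrableOn.congr_fun h (fun w hw => ?_) measurableSet_Ioi
  have hw : 0 < w := hw
  simp only [RCLike.re_to_complex]
  rw [← Complex.ofReal_one, ← Complex.ofReal_sub, ← Complex.ofReal_add, ← Complex.ofReal_neg,
    ← Complex.ofReal_cpow hw.le, ← Complex.ofReal_cpow (by positivity), ← Complex.ofReal_mul,
    Complex.ofReal_re]

/-- The Euler-type integral representation of `G^{2,1}_{1,2}`. -/
lemma meijerG2112_eq_integral {s ρ θ : ℝ} (hs : 0 < s) (hρ : 0 < ρ) (hθ : 0 < θ) :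
    meijerG2112 (1 - s) 0 (ρ - s) θ
      = Real.Gamma ρ * ∫ w in Ioi (0 : ℝ), w ^ (s - 1) * Real.exp (-(θ * w)) * (1 + w) ^ (-ρ) := by
  -- The midpoint abscissa `σ` lies strictly between `max 0 (s - ρ)` and `s`, so all three Gamma
  -- factors have arguments with positive real part.
  have hσ : ∃ σ : ℝ, (max (-0) (-(ρ - s)) + (1 - (1 - s))) / 2 = σ ∧ 0 < σ ∧ σ < s ∧ 0 < ρ - s + σ := by
    have h1 := le_max_left (-0 : ℝ) (-(ρ - s))
    have h2 := le_max_right (-0 : ℝ) (-(ρ - s))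
    have h3 : max (-0 : ℝ) (-(ρ - s)) < s := max_lt (by linarith) (by linarith)
    generalize max (-0 : ℝ) (-(ρ - s)) = m at h1 h2 h3
    exact ⟨_, rfl, by linarith, by linarith, by linarith⟩
  obtain ⟨σ, hσe, hσ0, hσs, hσρ⟩ := hσ
  set τ : ℝ → ℂ := fun t => σ + t * Complex.I with hτ
  set F : ℝ → ℝ → ℂ := fun t w => ((θ : ℂ) ^ (-τ t) * Complex.Gamma (τ t)) *
    ((w : ℂ) ^ ((s : ℂ) - τ t - 1) * ((1 + w : ℝ) : ℂ) ^ (-(ρ : ℂ))) with hF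
  have hB : ∀ t : ℝ, Complex.Gamma (ρ - s + τ t) * Complex.Gamma (s - τ t)
      = Complex.Gamma ρ * ∫ w in Ioi (0 : ℝ),
        ((w : ℂ) ^ ((s : ℂ) - τ t - 1) * ((1 + w : ℝ) : ℂ) ^ (-(ρ : ℂ))) := by
    intro t
    have hu : 0 < ((s : ℂ) - τ t).re := by simp [hτ]; linarith
    have hv : 0 < ((ρ : ℂ) - s + τ t).re := by simp [hτ]; linarith
    have h := (hasInt_beta hu hv).integral_eq
    rw [show (s : ℂ) - τ t + (ρ - s + τ t) = ρ by ring] at h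
    rw [h, mul_comm, Complex.Gamma_mul_Gamma_eq_betaIntegral hu hv]
    congr 2; ring
  have hFint : Integrable (Function.uncurry F) (volume.prod (volume.restrict (Ioi (0 : ℝ)))) := by
    -- The norm of `F t w` is exactly a function of `t` times a function of `w`, so joint
    -- integrability splits into the vertical Gamma bound and a real Beta integral.
    have hb : Integrable (fun p : ℝ × ℝ => (θ ^ (-σ) * ‖Complex.Gamma (τ p.1)‖) *
        (p.2 ^ ((s - σ) - 1) * (1 + p.2) ^ (-((s - σ) + (ρ - s + σ)))))
        (volume.prod (volume.restrict (Ioi (0 : ℝ)))) := by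
      refine Integrable.mul_prod (f := fun t : ℝ => θ ^ (-σ) * ‖Complex.Gamma (τ t)‖)
        (g := fun w : ℝ => w ^ ((s - σ) - 1) * (1 + w) ^ (-((s - σ) + (ρ - s + σ)))) ?_ ?_
      · exact (integrable_Gamma_vertical hσ0).norm.const_mul _
      · exact integrableOn_beta (by linarith) hσρ
    refine hb.mono' ?_ ?_
    · have h1 : Measurable (fun t : ℝ => Complex.Gamma (τ t)) :=
        (continuous_Gamma_vertical hσ0).measurable
      have h2 : Measurable τ := by fun_prop
      refine Measurable.aestronglyMeasurable ?_
      simp only [hF, Function.uncurry_def]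
      have h3 : Measurable (fun p : ℝ × ℝ => Complex.Gamma (τ p.1)) := h1.comp measurable_fst
      have h4 : Measurable (fun p : ℝ × ℝ => τ p.1) := h2.comp measurable_fst
      have h5 : Measurable (fun p : ℝ × ℝ => (p.2 : ℂ)) := by fun_prop
      have h6 : Measurable (fun p : ℝ × ℝ => ((1 + p.2 : ℝ) : ℂ)) := by fun_prop
      exact ((measurable_const.pow h4.neg).mul h3).mul
        ((h5.pow ((measurable_const.sub h4).sub_const 1)).mul (h6.pow measurable_const))
    · have h : ∀ᵐ p : ℝ × ℝ ∂(volume.prod (volume.restrict (Ioi (0 : ℝ)))), p.2 ∈ Ioi (0 : ℝ) :=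
        Measure.quasiMeasurePreserving_snd.ae (ae_restrict_mem measurableSet_Ioi)
      filter_upwards [h] with p hp
      have hp : 0 < p.2 := hp
      simp only [hF, Function.uncurry_def, norm_mul]
      rw [Complex.norm_cpow_eq_rpow_re_of_pos hθ, Complex.norm_cpow_eq_rpow_re_of_pos hp,
        Complex.norm_cpow_eq_rpow_re_of_pos (by positivity)]
      refine le_of_eq ?_
      congr 2
      · simp [hτ]
      · simp [hτ]
      · congr 1; simp
  have hswap := integral_integral_swap (μ := volume) (ν := volume.restrict (Ioi (0 : ℝ)))
    (f := F) hFint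
  -- At fixed `w` the `t`-integral is the inverse Mellin transform of `Γ` at `θ w`.
  have hinner : ∀ w ∈ Ioi (0 : ℝ), ((1 / (2 * Real.pi) : ℝ) : ℂ) * ∫ t, F t w
      = ((w ^ (s - 1) * Real.exp (-(θ * w)) * (1 + w) ^ (-ρ) : ℝ) : ℂ) := by
    intro w hw
    have hw : 0 < w := hw
    have hwc : (w : ℂ) ≠ 0 := by exact_mod_cast hw.ne'
    have h := mellinInv_Gamma hσ0 (mul_pos hθ hw)
    rw [mellinInv, Complex.real_smul] at h
    have e : ∀ t : ℝ, F t w = ((w ^ (s - 1) * (1 + w) ^ (-ρ) : ℝ) : ℂ) *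
        (((θ * w : ℝ) : ℂ) ^ (-(σ + t * Complex.I)) • Complex.Gamma (σ + t * Complex.I)) := by
      intro t
      simp only [hF, smul_eq_mul]
      rw [show (s : ℂ) - τ t - 1 = (s - 1) + (-τ t) by ring, Complex.cpow_add _ _ hwc,
        Complex.ofReal_mul θ w, Complex.mul_cpow_ofReal_nonneg hθ.le hw.le, Complex.ofReal_mul,
        Complex.ofReal_cpow hw.le, Complex.ofReal_cpow (by positivity)]
      push_cast
      simp only [hτ]
      ring
    simp_rw [e]
    rw [integral_const_mul, mul_left_comm, h]
    push_cast
    ring_nf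
  rw [meijerG2112, hσe, mellinInv]
  have hfun : ∀ t : ℝ, (θ : ℂ) ^ (-(σ + t * Complex.I)) • (Complex.Gamma (((0 : ℝ) : ℂ) + (σ + t * Complex.I))
      * Complex.Gamma (((ρ - s : ℝ) : ℂ) + (σ + t * Complex.I))
      * Complex.Gamma (1 - ((1 - s : ℝ) : ℂ) - (σ + t * Complex.I)))
      = Complex.Gamma ρ * ∫ w in Ioi (0 : ℝ), F t w := by
    intro t
    simp only [hF, integral_const_mul]
    rw [mul_left_comm, ← hB t]
    simp only [hτ, smul_eq_mul]
    push_cast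
    ring_nf
  simp_rw [hfun]
  rw [integral_const_mul, hswap, Complex.real_smul, mul_left_comm, ← integral_const_mul,
    setIntegral_congr_fun measurableSet_Ioi hinner, integral_complex_ofReal, Complex.Gamma_ofReal,
    ← Complex.ofReal_mul, Complex.ofReal_re]

/-! ### Linearity of integrals, with integrability carried along -/

namespace HasInt

variable {α : Type*} [MeasurableSpace α] {μ : Measure α} {f g : α → ℝ} {a b : ℝ}

lemma add (hf : HasInt μ f a) (hg : HasInt μ g b) : HasInt μ (fun x => f x + g x) (a + b) :=
  ⟨hf.integrable.add hg.integrable, by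
    rw [integral_add hf.integrable hg.integrable, hf.integral_eq, hg.integral_eq]⟩

lemma const_mul (hf : HasInt μ f a) (c : ℝ) : HasInt μ (fun x => c * f x) (c * a) :=
  ⟨hf.integrable.const_mul c, by rw [integral_const_mul, hf.integral_eq]⟩

lemma sum {ι : Type*} (s : Finset ι) {f : ι → α → ℝ} {a : ι → ℝ}
    (h : ∀ i ∈ s, HasInt μ (f i) (a i)) : HasInt μ (fun x => ∑ i ∈ s, f i x) (∑ i ∈ s, a i) :=
  ⟨integrable_finsetSum _ fun i hi => (h i hi).integrable, by
    rw [integral_finsetSum _ fun i hi => (h i hi).integrable]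
    exact Finset.sum_congr rfl fun i hi => (h i hi).integral_eq⟩

lemma congr (hf : HasInt μ f a) (h : f =ᵐ[μ] g) (hab : a = b) : HasInt μ g b :=
  ⟨hf.integrable.congr h, by rw [← integral_congr_ae h, hf.integral_eq, hab]⟩

end HasInt

/-! ### Incomplete gamma integrals at integer parameters -/

/-- Differentiation telescopes: the derivative of each monomial cancels the exponential's
contribution from the preceding one, and only the last term survives. -/
lemma hasDerivAt_exp_mul_expSum (m : ℕ) (D t : ℝ) :
    HasDerivAt (fun t : ℝ => Real.exp (-(D * t)) * ∑ p ∈ Finset.range (m + 1), (D * t) ^ p / (p.factorial : ℝ))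
      (-(D * Real.exp (-(D * t)) * ((D * t) ^ m / (m.factorial : ℝ)))) t := by
  have hl : HasDerivAt (fun t : ℝ => D * t) D t := by simpa using (hasDerivAt_id t).const_mul D
  have he : HasDerivAt (fun t : ℝ => Real.exp (-(D * t))) (Real.exp (-(D * t)) * -D) t := hl.neg.exp
  induction m with
  | zero =>
    simp only [zero_add, Finset.range_one, Finset.sum_singleton, pow_zero, Nat.factorial_zero,
      Nat.cast_one, div_one, mul_one]
    convert! he using 1
    ring
  | succ m ih =>
    have h2 := he.mul ((hl.pow (m + 1)).div_const ((m + 1).factorial : ℝ))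
    have := ih.add h2
    simp_rw [Finset.sum_range_succ _ (m + 1), mul_add]
    convert! this using 1
    have h3 : ((m + 1).factorial : ℝ) = (m + 1) * m.factorial := by
      rw [Nat.factorial_succ]; push_cast; ring
    have h4 : (m.factorial : ℝ) ≠ 0 := by positivity
    simp only [Nat.add_sub_cancel, h3, Pi.pow_apply]
    push_cast
    field_simp
    ring

lemma tendsto_exp_mul_expSum (m : ℕ) {D : ℝ} (hD : 0 < D) :
    Tendsto (fun t : ℝ => Real.exp (-(D * t)) * ∑ p ∈ Finset.range (m + 1), (D * t) ^ p / (p.factorial : ℝ))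
      atTop (𝓝 0) := by
  have h : Tendsto (fun s : ℝ => ∑ p ∈ Finset.range (m + 1), s ^ p * Real.exp (-s) / (p.factorial : ℝ))
      atTop (𝓝 (∑ p ∈ Finset.range (m + 1), 0 / (p.factorial : ℝ))) :=
    tendsto_finsetSum _ fun p _ =>
      (Real.tendsto_pow_mul_exp_neg_atTop_nhds_zero p).div_const _
  simp only [zero_div, Finset.sum_const_zero] at h
  refine (h.comp (tendsto_id.const_mul_atTop hD)).congr fun t => ?_
  simp only [Function.comp, id, Finset.mul_sum]
  exact Finset.sum_congr rfl fun p _ => by ring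

/-- The upper incomplete gamma function at a positive integer. -/
lemma hasInt_pow_mul_exp_Ioi (m : ℕ) {D lam : ℝ} (hD : 0 < D) (hlam : 0 ≤ lam) :
    HasInt (volume.restrict (Ioi lam)) (fun t : ℝ => t ^ m * Real.exp (-(D * t)))
      (m.factorial / D ^ (m + 1) * (Real.exp (-(D * lam)) *
        ∑ p ∈ Finset.range (m + 1), (D * lam) ^ p / (p.factorial : ℝ))) := by
  -- An antiderivative that vanishes at infinity; the integrand is nonnegative, so its limit also
  -- yields integrability.
  set G : ℝ → ℝ := fun t => -(m.factorial / D ^ (m + 1)) * (Real.exp (-(D * t)) *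
        ∑ p ∈ Finset.range (m + 1), (D * t) ^ p / (p.factorial : ℝ)) with hG
  have hd : ∀ t ∈ Ici lam, HasDerivAt G (t ^ m * Real.exp (-(D * t))) t := by
    intro t _
    convert! (hasDerivAt_exp_mul_expSum m D t).const_mul (-(m.factorial / D ^ (m + 1))) using 1
    have h4 : (m.factorial : ℝ) ≠ 0 := by positivity
    field_simp
    ring
  have hpos : ∀ t ∈ Ioi lam, 0 ≤ t ^ m * Real.exp (-(D * t)) := fun t ht => by
    have : 0 ≤ t := hlam.trans (le_of_lt ht)
    positivity
  have ht : Tendsto G atTop (𝓝 0) := by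
    have := (tendsto_exp_mul_expSum m hD).const_mul (-(m.factorial / D ^ (m + 1) : ℝ))
    rwa [mul_zero] at this
  refine ⟨integrableOn_Ioi_deriv_of_nonneg' hd hpos ht, ?_⟩
  rw [integral_Ioi_of_hasDerivAt_of_nonneg' hd hpos ht]
  simp only [hG]; ring

/-! ### Moments of the gamma distribution -/

lemma ae_pos_gammaMeasure (a r : ℝ) : ∀ᵐ t ∂gammaMeasure a r, 0 < t := by
  have hm : Measurable (gammaPDF a r) := (measurable_gammaPDFReal a r).ennreal_ofReal
  rw [gammaMeasure, ae_withDensity_iff hm]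
  -- The density need not vanish at `0` (it does not for `a = 1`, `r > 0`), so the origin is
  -- discarded as a Lebesgue null set.
  have h0 : ∀ᵐ t : ℝ, t ≠ 0 := by simp [ae_iff, measure_singleton]
  filter_upwards [h0] with t ht hne
  by_contra hlt
  exact hne (gammaPDF_of_neg (lt_of_le_of_ne (not_lt.1 hlt) ht))

lemma hasInt_gammaMeasure {a r : ℝ} (ha : 0 < a) (hr : 0 < r) {f : ℝ → ℝ} {c : ℝ}
    (h : HasInt (volume.restrict (Ioi 0))
      (fun t => r ^ a / Real.Gamma a * t ^ (a - 1) * Real.exp (-(r * t)) * f t) c) :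
    HasInt (gammaMeasure a r) f c := by
  have hae : (fun t => (gammaPDF a r t).toReal • f t) =ᵐ[volume] (Ioi (0 : ℝ)).indicator
      (fun t => r ^ a / Real.Gamma a * t ^ (a - 1) * Real.exp (-(r * t)) * f t) := by
    have h0 : ∀ᵐ t : ℝ, t ≠ 0 := by simp [ae_iff, measure_singleton]
    filter_upwards [h0] with t ht
    rcases lt_or_gt_of_ne ht with h1 | h1
    · rw [gammaPDF_of_neg h1, indicator_of_notMem (by simpa using h1.le)]; simp
    · rw [indicator_of_mem (show t ∈ Ioi (0 : ℝ) from h1), gammaPDF,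
        ENNReal.toReal_ofReal (gammaPDFReal_nonneg ha hr t), gammaPDFReal, if_pos h1.le, smul_eq_mul]
  have hm : Measurable (gammaPDF a r) := (measurable_gammaPDFReal a r).ennreal_ofReal
  have hfin : ∀ᵐ t : ℝ, gammaPDF a r t < ⊤ := ae_of_all _ fun t => ENNReal.ofReal_lt_top
  constructor
  · rw [gammaMeasure, integrable_withDensity_iff_integrable_smul' hm hfin, integrable_congr hae,
      integrable_indicator_iff measurableSet_Ioi]
    exact h.integrable
  · rw [gammaMeasure, integral_withDensity_eq_integral_toReal_smul hm hfin, integral_congr_ae hae,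
      integral_indicator measurableSet_Ioi, h.integral_eq]

lemma hasInt_rpow_mul_exp {a r : ℝ} (ha : 0 < a) (hr : 0 < r) :
    HasInt (volume.restrict (Ioi 0)) (fun t : ℝ => t ^ (a - 1) * Real.exp (-(r * t)))
      (Real.Gamma a / r ^ a) := by
  have h := Real.integral_rpow_mul_exp_neg_mul_Ioi ha hr
  have hpos : 0 < (1 / r) ^ a * Real.Gamma a := by positivity
  -- A non-integrable function has integral `0` by convention, so a positive value proves
  -- integrability.
  refine ⟨Integrable.of_integral_ne_zero (by rw [h]; exact hpos.ne'), ?_⟩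
  rw [h, Real.div_rpow zero_le_one hr.le, Real.one_rpow]; ring

/-- Laplace-type moments of the gamma distribution. -/
lemma hasInt_gammaMeasure_pow_mul_exp {a r c : ℝ} (ha : 0 < a) (hr : 0 < r) (hc : 0 ≤ c) (l : ℕ) :
    HasInt (gammaMeasure a r) (fun t => t ^ l * Real.exp (-(c * t)))
      (r ^ a / Real.Gamma a * (Real.Gamma (a + l) / (r + c) ^ (a + l))) := by
  refine hasInt_gammaMeasure ha hr ?_
  have hal : 0 < a + l := by positivity
  refine ((hasInt_rpow_mul_exp hal (by positivity : 0 < r + c)).const_mul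
    (r ^ a / Real.Gamma a)).congr ?_ rfl
  filter_upwards [ae_restrict_mem measurableSet_Ioi] with t ht
  have ht : 0 < t := ht
  rw [show a + l - 1 = (a - 1) + (l : ℝ) by ring, Real.rpow_add ht, Real.rpow_natCast,
    show -((r + c) * t) = -(r * t) + -(c * t) by ring, Real.exp_add]
  ring

/-- Moments of the gamma distribution against a negative power, in terms of Meijer's function. -/
lemma hasInt_gammaMeasure_meijer {a r c b d ρ : ℝ} (ha : 0 < a) (hr : 0 < r) (hc : 0 ≤ c)
    (hb : 0 < b) (hd : 0 < d) (hρ : 0 < ρ) (l : ℕ) :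
    HasInt (gammaMeasure a r) (fun t => t ^ l * Real.exp (-(c * t)) * (b + d * t) ^ (-ρ))
      (r ^ a / Real.Gamma a * ((b / d) ^ (a + l) * b ^ (-ρ) / Real.Gamma ρ *
        meijerG2112 (1 - (a + l)) 0 (ρ - (a + l)) ((r + c) * (b / d)))) := by
  have hal : 0 < a + l := by positivity
  have hrc : 0 < r + c := by positivity
  refine hasInt_gammaMeasure ha hr ?_
  set s : ℝ := a + l with hs
  set f : ℝ → ℝ := fun t => t ^ (s - 1) * Real.exp (-((r + c) * t)) * (b + d * t) ^ (-ρ) with hf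
  -- Since `ρ > 0`, the negative power is at most its value `b ^ (-ρ)` at `t = 0`, which leaves a
  -- gamma integrand.
  have hfint : IntegrableOn f (Ioi 0) := by
    refine ((hasInt_rpow_mul_exp hal hrc).integrable.mul_const (b ^ (-ρ))).mono' ?_ ?_
    · exact Measurable.aestronglyMeasurable (by fun_prop)
    · filter_upwards [ae_restrict_mem measurableSet_Ioi] with t ht
      have ht : 0 < t := ht
      simp only [hf]
      rw [Real.norm_of_nonneg (by positivity)]
      refine mul_le_mul_of_nonneg_left ?_ (by positivity)
      exact Real.rpow_le_rpow_of_nonpos hb (by nlinarith) (by linarith)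
  have hfval : ∫ t in Ioi 0, f t = (b / d) ^ s * b ^ (-ρ) / Real.Gamma ρ *
      meijerG2112 (1 - s) 0 (ρ - s) ((r + c) * (b / d)) := by
    have hbd : 0 < b / d := by positivity
    rw [meijerG2112_eq_integral hal hρ (by positivity)]
    -- The scaling `t = (b / d) w` turns `b + d t` into `b (1 + w)`.
    have h1 := integral_comp_mul_left_Ioi f 0 hbd
    rw [mul_zero, smul_eq_mul, eq_comm, inv_mul_eq_iff_eq_mul₀ hbd.ne'] at h1
    rw [h1]
    have h2 : ∀ w ∈ Ioi (0 : ℝ), f (b / d * w) = ((b / d) ^ (s - 1) * b ^ (-ρ)) *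
        (w ^ (s - 1) * Real.exp (-((r + c) * (b / d) * w)) * (1 + w) ^ (-ρ)) := by
      intro w hw
      have hw : 0 < w := hw
      simp only [hf]
      rw [Real.mul_rpow hbd.le hw.le, show b + d * (b / d * w) = b * (1 + w) by field_simp,
        Real.mul_rpow hb.le (by positivity), ← mul_assoc (r + c)]
      ring
    rw [setIntegral_congr_fun measurableSet_Ioi h2, integral_const_mul, Real.rpow_sub hbd,
      Real.rpow_one]
    have hG : Real.Gamma ρ ≠ 0 := (Real.Gamma_pos_of_pos hρ).ne'
    field_simp
  refine (HasInt.const_mul ⟨hfint, hfval⟩ (r ^ a / Real.Gamma a)).congr ?_ rfl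
  filter_upwards [ae_restrict_mem measurableSet_Ioi] with t ht
  have ht : 0 < t := ht
  simp only [hf]
  rw [hs, show a + l - 1 = (a - 1) + (l : ℝ) by ring, Real.rpow_add ht, Real.rpow_natCast,
    show -((r + c) * t) = -(r * t) + -(c * t) by ring, Real.exp_add]
  ring

/-! ### Erlang survival functions and their averages over the gains -/

/-- Survival function of the Erlang distribution with shape `n` and rate `r`. -/
noncomputable def erlangTail (n : ℕ) (r t : ℝ) : ℝ :=
  Real.exp (-(r * t)) * ∑ q ∈ Finset.range n, (r * t) ^ q / (q.factorial : ℝ)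

lemma gammaMeasure_real_Ici {n : ℕ} (hn : 0 < n) {r t : ℝ} (hr : 0 < r) (ht : 0 ≤ t) :
    (gammaMeasure n r).real (Ici t) = erlangTail n r t := by
  obtain ⟨m, rfl⟩ : ∃ m, n = m + 1 := ⟨n - 1, by omega⟩
  have hm : (0 : ℝ) < ((m + 1 : ℕ) : ℝ) := by positivity
  have hG : Real.Gamma ((m + 1 : ℕ) : ℝ) = m.factorial := by
    push_cast; exact Real.Gamma_nat_eq_factorial m
  have h := hasInt_gammaMeasure hm hr (f := (Ici t).indicator 1) (c := erlangTail (m + 1) r t) ?_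
  · rw [← h.integral_eq, integral_indicator_one measurableSet_Ici]
  have h1 := (hasInt_pow_mul_exp_Ioi m hr ht).const_mul (r ^ (m + 1) / m.factorial)
  have hfac : (m.factorial : ℝ) ≠ 0 := by positivity
  have e : (fun s : ℝ => r ^ ((m + 1 : ℕ) : ℝ) / Real.Gamma ((m + 1 : ℕ) : ℝ) *
      s ^ (((m + 1 : ℕ) : ℝ) - 1) * Real.exp (-(r * s)) * (Ici t).indicator 1 s)
      = (Ici t).indicator (fun s => r ^ (m + 1) / m.factorial * (s ^ m * Real.exp (-(r * s)))) := by
    funext s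
    by_cases hs : s ∈ Ici t
    · rw [indicator_of_mem hs, indicator_of_mem hs, hG, Real.rpow_natCast,
        show ((m + 1 : ℕ) : ℝ) - 1 = m by push_cast; ring, Real.rpow_natCast]
      simp; ring
    · rw [indicator_of_notMem hs, indicator_of_notMem hs, mul_zero]
  rw [e]
  have hset : (volume.restrict (Ioi (0 : ℝ))).restrict (Ici t) = volume.restrict (Ioi t) := by
    rw [Measure.restrict_restrict measurableSet_Ici]
    refine Measure.restrict_congr_set ?_
    have h0 : ∀ᵐ s : ℝ, s ≠ t := by simp [ae_iff, measure_singleton]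
    filter_upwards [h0] with s hs
    refine propext ⟨fun h => lt_of_le_of_ne h.1 (Ne.symm hs), fun h => ⟨le_of_lt h, lt_of_le_of_lt ht h⟩⟩
  constructor
  · rw [integrable_indicator_iff measurableSet_Ici, IntegrableOn, hset]
    exact h1.integrable
  · rw [integral_indicator measurableSet_Ici, hset, h1.integral_eq, erlangTail]
    field_simp

lemma hasInt_gammaMeasure_indicator {a r : ℝ} (ha : 0 < a) (hr : 0 < r) {S : Set ℝ}
    (hS : MeasurableSet S) (hS0 : S ⊆ Ioi 0) {f : ℝ → ℝ} {c : ℝ}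
    (h : HasInt (volume.restrict S)
      (fun t => r ^ a / Real.Gamma a * t ^ (a - 1) * Real.exp (-(r * t)) * f t) c) :
    HasInt (gammaMeasure a r) (S.indicator f) c := by
  refine hasInt_gammaMeasure ha hr ?_
  have e : (fun t => r ^ a / Real.Gamma a * t ^ (a - 1) * Real.exp (-(r * t)) * S.indicator f t)
      = S.indicator (fun t => r ^ a / Real.Gamma a * t ^ (a - 1) * Real.exp (-(r * t)) * f t) := by
    funext t
    by_cases ht : t ∈ S
    · simp [ht]
    · simp [ht]
  have hset : (volume.restrict (Ioi (0 : ℝ))).restrict S = volume.restrict S := by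
    rw [Measure.restrict_restrict hS, inter_eq_left.2 hS0]
  rw [e]
  refine ⟨?_, ?_⟩
  · rw [integrable_indicator_iff hS, IntegrableOn, hset]
    exact h.integrable
  · rw [integral_indicator hS, hset, h.integral_eq]

lemma integrableOn_rpow_mul_exp {a : ℝ} (ha : 0 < a) :
    IntegrableOn (fun t : ℝ => t ^ (a - 1) * Real.exp (-t)) (Ioi 0) :=
  (Real.GammaIntegral_convergent ha).congr_fun (fun _ _ => mul_comm _ _) measurableSet_Ioi

lemma lowerGamma_add_upperGamma {a x : ℝ} (ha : 0 < a) (hx : 0 ≤ x) :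
    lowerGamma a x + upperGamma a x = Real.Gamma a := by
  have h := integrableOn_rpow_mul_exp ha
  rw [lowerGamma, upperGamma, ← setIntegral_union (Ioc_disjoint_Ioi le_rfl) measurableSet_Ioi
    (h.mono_set Ioc_subset_Ioi_self) (h.mono_set (Ioi_subset_Ioi hx)), Ioc_union_Ioi_eq_Ioi hx,
    Real.Gamma_eq_integral ha]
  exact setIntegral_congr_fun measurableSet_Ioi fun t _ => mul_comm _ _

lemma hasInt_gammaMeasure_Ioc {a r lam : ℝ} (ha : 0 < a) (hr : 0 < r) (hlam : 0 ≤ lam) (c : ℝ) :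
    HasInt (gammaMeasure a r) ((Ioc 0 lam).indicator fun _ => c)
      (lowerGamma a (r * lam) / Real.Gamma a * c) := by
  refine hasInt_gammaMeasure_indicator ha hr measurableSet_Ioc Ioc_subset_Ioi_self ?_
  have hint := (hasInt_rpow_mul_exp ha hr).integrable
  have hval : ∫ t in Ioc 0 lam, t ^ (a - 1) * Real.exp (-(r * t)) = lowerGamma a (r * lam) / r ^ a := by
    rw [lowerGamma, ← intervalIntegral.integral_of_le hlam,
      ← intervalIntegral.integral_of_le (by positivity)]
    have h1 := intervalIntegral.integral_comp_mul_left (a := 0) (b := lam)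
      (fun t : ℝ => t ^ (a - 1) * Real.exp (-t)) hr.ne'
    rw [mul_zero, smul_eq_mul, eq_comm, inv_mul_eq_iff_eq_mul₀ hr.ne'] at h1
    rw [h1]
    have h2 : ∀ t ∈ uIcc 0 lam, (r * t) ^ (a - 1) * Real.exp (-(r * t))
        = r ^ (a - 1) * (t ^ (a - 1) * Real.exp (-(r * t))) := by
      intro t ht
      rw [uIcc_of_le hlam] at ht
      rw [Real.mul_rpow hr.le ht.1]; ring
    rw [intervalIntegral.integral_congr h2, intervalIntegral.integral_const_mul,
      Real.rpow_sub hr, Real.rpow_one]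
    field_simp
  have hint' : IntegrableOn (fun t : ℝ => t ^ (a - 1) * Real.exp (-(r * t))) (Ioc 0 lam) :=
    IntegrableOn.mono_set hint Ioc_subset_Ioi_self
  refine (HasInt.const_mul ⟨hint', hval⟩ (r ^ a / Real.Gamma a * c)).congr
    (ae_of_all _ fun t => ?_) ?_
  · simp only; ring
  · have : r ^ a ≠ 0 := by positivity
    field_simp

/-- Expanding the binomials separates `t` into monomials times one exponential, which can be
integrated against a gamma law. -/
lemma erlangTail_add_mul (n : ℕ) (r a w t : ℝ) :
    erlangTail n r (a + t * w) = Real.exp (-(r * a)) * ∑ k ∈ Finset.range n, r ^ k / (k.factorial : ℝ) *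
      ∑ j ∈ Finset.range (k + 1), (k.choose j : ℝ) * a ^ (k - j) * w ^ j *
        (t ^ j * Real.exp (-(r * w * t))) := by
  rw [erlangTail, show -(r * (a + t * w)) = -(r * a) + -(r * w * t) by ring, Real.exp_add, mul_assoc]
  congr 1
  rw [Finset.mul_sum]
  refine Finset.sum_congr rfl fun k _ => ?_
  rw [mul_pow, add_comm a, add_pow, Finset.mul_sum, Finset.sum_div, Finset.mul_sum, Finset.mul_sum]
  refine Finset.sum_congr rfl fun j _ => ?_
  rw [mul_pow]; ring

/-- Average of the Erlang survival function over the gain of the link to the primary user: power is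
maximal below the level `lam` and inversely proportional to the gain above it. -/
lemma hasInt_erlangTail_txPower (x : ℕ) {y : ℕ} (hy : 0 < y) {w lam : ℝ} (a b : ℝ) (hw : 0 ≤ w)
    (hlam : 0 ≤ lam) :
    HasInt (gammaMeasure y y)
      (fun Y => if Y ≤ lam then erlangTail x x a else erlangTail x x (b + Y * w))
      (lowerGamma y (y * lam) / Real.Gamma y * erlangTail x x a +
        (y : ℝ) ^ (y : ℝ) / Real.Gamma y * Real.exp (-(x * b)) * ∑ k ∈ Finset.range x,
          (x : ℝ) ^ k / (k.factorial : ℝ) * ∑ j ∈ Finset.range (k + 1),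
            (k.choose j : ℝ) * b ^ (k - j) * w ^ j * (Real.Gamma (y + j) / (y + x * w) ^ (y + j) *
              (Real.exp (-((y + x * w) * lam)) *
                ∑ p ∈ Finset.range (y + j), ((y + x * w) * lam) ^ p / (p.factorial : ℝ)))) := by
  have hy' : (0 : ℝ) < y := by exact_mod_cast hy
  have hD : 0 < (y : ℝ) + x * w := by positivity
  have h2 : HasInt (gammaMeasure y y) ((Ioi lam).indicator fun Y => erlangTail x x (b + Y * w))
      ((y : ℝ) ^ (y : ℝ) / Real.Gamma y * Real.exp (-(x * b)) * ∑ k ∈ Finset.range x,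
          (x : ℝ) ^ k / (k.factorial : ℝ) * ∑ j ∈ Finset.range (k + 1),
            (k.choose j : ℝ) * b ^ (k - j) * w ^ j * (Real.Gamma (y + j) / (y + x * w) ^ (y + j) *
              (Real.exp (-((y + x * w) * lam)) *
                ∑ p ∈ Finset.range (y + j), ((y + x * w) * lam) ^ p / (p.factorial : ℝ)))) := by
    refine hasInt_gammaMeasure_indicator hy' hy' measurableSet_Ioi (Ioi_subset_Ioi hlam) ?_
    have hj : ∀ j : ℕ, HasInt (volume.restrict (Ioi lam))
        (fun t => t ^ (y - 1 + j) * Real.exp (-((y + x * w) * t)))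
        (Real.Gamma (y + j) / (y + x * w) ^ (y + j) *
              (Real.exp (-((y + x * w) * lam)) *
                ∑ p ∈ Finset.range (y + j), ((y + x * w) * lam) ^ p / (p.factorial : ℝ))) := by
      intro j
      have h := hasInt_pow_mul_exp_Ioi (y - 1 + j) hD hlam
      have e : y - 1 + j + 1 = y + j := by omega
      rw [e] at h
      -- The factorial is kept as `Γ(y + j)` because it later cancels the `1 / Γ(ρ)`, `ρ = y + j`,
      -- of the Meijer moment.
      have hG : Real.Gamma ((y : ℝ) + j) = (y - 1 + j).factorial := by
        rw [← Real.Gamma_nat_eq_factorial]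
        congr 1
        rw [← Nat.cast_add, ← e]; push_cast; ring
      rwa [hG]
    refine ((HasInt.sum (Finset.range x) fun k _ => (HasInt.sum (Finset.range (k + 1)) fun j _ =>
      (hj j).const_mul ((k.choose j : ℝ) * b ^ (k - j) * w ^ j)).const_mul
        ((x : ℝ) ^ k / (k.factorial : ℝ))).const_mul
          ((y : ℝ) ^ (y : ℝ) / Real.Gamma y * Real.exp (-(x * b)))).congr ?_ rfl
    filter_upwards [ae_restrict_mem measurableSet_Ioi] with t ht
    have ht : 0 < t := lt_of_le_of_lt hlam ht
    rw [erlangTail_add_mul, show (y : ℝ) - 1 = ((y - 1 : ℕ) : ℝ) by rw [Nat.cast_pred hy],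
      Real.rpow_natCast t (y - 1)]
    simp only [Finset.mul_sum]
    refine Finset.sum_congr rfl fun k _ => Finset.sum_congr rfl fun j _ => ?_
    rw [pow_add, show -(((y : ℝ) + x * w) * t) = -(y * t) + -(x * w * t) by ring, Real.exp_add]
    ring
  refine ((hasInt_gammaMeasure_Ioc hy' hy' hlam (erlangTail x x a)).add h2).congr ?_ rfl
  filter_upwards [ae_pos_gammaMeasure y y] with Y hY
  by_cases h : Y ≤ lam
  · rw [indicator_of_mem (show Y ∈ Ioc 0 lam from ⟨hY, h⟩), indicator_of_notMem (by simpa using h),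
      if_pos h, add_zero]
  · rw [indicator_of_notMem (fun hm => h hm.2), indicator_of_mem (by simpa using h), if_neg h, zero_add]

/-- Average of the Erlang survival function over the gain of the interfering link. -/
lemma hasInt_erlangTail_interference (x : ℕ) {z I : ℝ} (hz : 0 < z) (hI : 0 ≤ I) (a : ℝ) :
    HasInt (gammaMeasure z z) (fun Z => erlangTail x x (a + Z * I))
      (z ^ z * Real.exp (-x * a) / Real.Gamma z * ∑ q ∈ Finset.range x,
        (x : ℝ) ^ q / (q.factorial : ℝ) * ∑ l ∈ Finset.range (q + 1), (q.choose l : ℝ)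
          * (a ^ (q - l) * I ^ l * Real.Gamma (z + l) / (z + x * I) ^ (z + l))) := by
  refine ((HasInt.sum (Finset.range x) fun k _ => (HasInt.sum (Finset.range (k + 1)) fun j _ =>
      (hasInt_gammaMeasure_pow_mul_exp hz hz (by positivity : (0 : ℝ) ≤ x * I) j).const_mul
        ((k.choose j : ℝ) * a ^ (k - j) * I ^ j)).const_mul
        ((x : ℝ) ^ k / (k.factorial : ℝ))).const_mul (Real.exp (-(x * a)))).congr
    (ae_of_all _ fun Z => (erlangTail_add_mul x x a I Z).symm) ?_
  simp only [Finset.mul_sum]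
  refine Finset.sum_congr rfl fun k _ => Finset.sum_congr rfl fun j _ => ?_
  rw [neg_mul]
  ring

/-- Gathers the powers of one summand of the Meijer sum. With every base written as an exponential,
it is a linear identity between exponents. -/
lemma rpow_collect {x U b : ℝ} (hx : 0 < x) (hU : 0 < U) (hb : 0 < b) (z : ℝ) (k j u y : ℕ) {p t : ℕ}
    (ht : t ≤ p) :
    x ^ k * U ^ u * (x * U) ^ t * b ^ (p - t) * ((b / (x * U)) ^ (z + ((u + t : ℕ) : ℝ))
        * b ^ (-((y : ℝ) + j)))
      = x ^ ((k : ℝ) - z - u) / U ^ z * b ^ ((p : ℝ) + u - j - y + z) := by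
  obtain ⟨X, rfl⟩ : ∃ X, Real.exp X = x := ⟨_, Real.exp_log hx⟩
  obtain ⟨V, rfl⟩ : ∃ X, Real.exp X = U := ⟨_, Real.exp_log hU⟩
  obtain ⟨B, rfl⟩ : ∃ X, Real.exp X = b := ⟨_, Real.exp_log hb⟩
  simp only [← Real.rpow_natCast, ← Real.exp_add, ← Real.exp_sub, ← Real.exp_mul]
  congr 1
  push_cast [Nat.cast_sub ht]
  ring

/-- Average over the gain of the interfering link of the part of the survival probability in which
the transmit power is limited by the interference temperature. -/
lemma hasInt_meijer_sum {x y : ℕ} (hx : 0 < x) (hy : 0 < y) {z E V U lam : ℝ} (hz : 0 < z)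
    (hV : 0 ≤ V) (hU : 0 < U) (hlam : 0 ≤ lam) :
    HasInt (gammaMeasure z z)
      (fun Z => (y : ℝ) ^ (y : ℝ) / Real.Gamma y * Real.exp (-(x * E)) * ∑ k ∈ Finset.range x,
          (x : ℝ) ^ k / (k.factorial : ℝ) * ∑ j ∈ Finset.range (k + 1),
            (k.choose j : ℝ) * E ^ (k - j) * (V + Z * U) ^ j *
              (Real.Gamma (y + j) / (y + x * (V + Z * U)) ^ (y + j) *
              (Real.exp (-((y + x * (V + Z * U)) * lam)) *
                ∑ p ∈ Finset.range (y + j), ((y + x * (V + Z * U)) * lam) ^ p / (p.factorial : ℝ))))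
      (z ^ z * Real.exp (-lam * (y + x * V)) / Real.Gamma z
        * ((y : ℝ) ^ (y : ℝ) * Real.exp (-x * E) / (U ^ z * Real.Gamma y))
        * ∑ k ∈ Finset.range x, ∑ j ∈ Finset.range (k + 1), ∑ u ∈ Finset.range (j + 1),
          ∑ p ∈ Finset.range (y + j), ∑ t ∈ Finset.range (p + 1),
          (x : ℝ) ^ ((k : ℝ) - z - u) / (k.factorial : ℝ)
          * (k.choose j : ℝ) * E ^ (k - j)
          * (j.choose u : ℝ) * V ^ (j - u)
          * (lam ^ p / (p.factorial : ℝ))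
          * (p.choose t : ℝ) * (y + x * V) ^ ((p : ℝ) + u - j - y + z)
          * meijerG2112 (1 - (z + u + t)) 0 (-z + y - t + j - u)
              ((z + x * lam * U) * (y + x * V) / (x * U))) := by
  have hx' : (0 : ℝ) < x := by exact_mod_cast hx
  have hy' : (0 : ℝ) < y := by exact_mod_cast hy
  have hb : 0 < (y : ℝ) + x * V := by positivity
  have hd : 0 < (x : ℝ) * U := by positivity
  -- One summand of the full expansion: the negative power has exponent `y + j`, while `Z` appears
  -- to the power `u` from `(V + Z U)^j` and `t` from the exponential sum.
  have hterm : ∀ k j u p t : ℕ, _ := fun k j u p t =>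
    (hasInt_gammaMeasure_meijer (ρ := y + j) hz hz (by positivity : 0 ≤ x * lam * U) hb hd
      (by positivity) (u + t)).const_mul
    ((y : ℝ) ^ (y : ℝ) / Real.Gamma y * Real.exp (-(x * E)) * ((x : ℝ) ^ k / (k.factorial : ℝ)) *
      ((k.choose j : ℝ) * E ^ (k - j)) * Real.Gamma (y + j) * Real.exp (-((y + x * V) * lam)) *
      ((j.choose u : ℝ) * V ^ (j - u) * U ^ u) * (lam ^ p / (p.factorial : ℝ)) *
      ((p.choose t : ℝ) * (x * U) ^ t * (y + x * V) ^ (p - t)))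
  refine (HasInt.sum (Finset.range x) fun k _ => HasInt.sum (Finset.range (k + 1)) fun j _ =>
    HasInt.sum (Finset.range (j + 1)) fun u _ => HasInt.sum (Finset.range (y + j)) fun p _ =>
      HasInt.sum (Finset.range (p + 1)) fun t _ => hterm k j u p t).congr ?_ ?_
  · filter_upwards [ae_pos_gammaMeasure z z] with Z hZ
    have hD : 0 < (y : ℝ) + x * V + x * U * Z := by positivity
    rw [Finset.mul_sum]
    refine Finset.sum_congr rfl fun k _ => ?_
    rw [Finset.mul_sum, Finset.mul_sum]
    refine Finset.sum_congr rfl fun j _ => ?_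
    rw [show (y : ℝ) + x * (V + Z * U) = y + x * V + x * U * Z by ring]
    have hw : (V + Z * U) ^ j = ∑ u ∈ Finset.range (j + 1),
        (j.choose u : ℝ) * V ^ (j - u) * U ^ u * Z ^ u := by
      rw [add_comm, add_pow]
      exact Finset.sum_congr rfl fun u _ => by rw [mul_pow]; ring
    have hp : ∀ p : ℕ, ((y + x * V + x * U * Z) * lam) ^ p / (p.factorial : ℝ)
        = ∑ t ∈ Finset.range (p + 1), lam ^ p / (p.factorial : ℝ) *
          ((p.choose t : ℝ) * (x * U) ^ t * (y + x * V) ^ (p - t)) * Z ^ t := by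
      intro p
      rw [mul_pow, add_comm _ (x * U * Z), add_pow, Finset.sum_mul, Finset.sum_div]
      exact Finset.sum_congr rfl fun t _ => by rw [mul_pow _ Z]; ring
    simp only [hp]
    have hsplit : Real.exp (-((y + x * V + x * U * Z) * lam))
        = Real.exp (-((y + x * V) * lam)) * Real.exp (-(x * lam * U * Z)) := by
      rw [← Real.exp_add]; congr 1; ring
    have hDpow : (y + x * V + x * U * Z) ^ (-((y : ℝ) + j))
        = ((y + x * V + x * U * Z) ^ (y + j))⁻¹ := by
      rw [Real.rpow_neg hD.le, ← Nat.cast_add, Real.rpow_natCast]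
    rw [hw, hsplit, div_eq_mul_inv (Real.Gamma ((y : ℝ) + j)), ← hDpow]
    simp only [Finset.sum_mul, Finset.mul_sum]
    -- The two sides nest the sums over `u`, `p` and `t` in different orders.
    rw [Finset.sum_comm]
    refine Finset.sum_congr rfl fun p _ => ?_
    rw [Finset.sum_comm]
    refine Finset.sum_congr rfl fun t _ => Finset.sum_congr rfl fun u _ => ?_
    rw [pow_add]
    ring
  · simp only [Finset.mul_sum]
    refine Finset.sum_congr rfl fun k _ => Finset.sum_congr rfl fun j _ =>
      Finset.sum_congr rfl fun u _ => Finset.sum_congr rfl fun p _ =>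
      Finset.sum_congr rfl fun t ht => ?_
    have htp : t ≤ p := by simpa [Nat.lt_succ_iff] using ht
    have hc := rpow_collect hx' hU hb z k j u y htp
    have e1 : (1 : ℝ) - (z + ((u + t : ℕ) : ℝ)) = 1 - (z + u + t) := by push_cast; ring
    have e2 : (y : ℝ) + j - (z + ((u + t : ℕ) : ℝ)) = -z + y - t + j - u := by push_cast; ring
    have e3 : (z + x * lam * U) * ((y + x * V) / (x * U))
        = (z + x * lam * U) * (y + x * V) / (x * U) := by ring
    have e4 : -((y + x * V) * lam) = -lam * (y + x * V) := by ring
    have hG : Real.Gamma ((y : ℝ) + j) ≠ 0 := (Real.Gamma_pos_of_pos (by positivity)).ne'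
    rw [e1, e2, e3, e4, neg_mul (x : ℝ) E]
    generalize meijerG2112 (1 - (z + u + t)) 0 (-z + y - t + j - u)
      ((z + x * lam * U) * (y + x * V) / (x * U)) = G
    calc _ = (x ^ k * U ^ u * (x * U) ^ t * (y + x * V) ^ (p - t) *
          (((y + x * V) / (x * U)) ^ (z + ((u + t : ℕ) : ℝ)) * (y + x * V) ^ (-((y : ℝ) + j)))) *
          ((y : ℝ) ^ (y : ℝ) / Real.Gamma y * Real.exp (-(x * E)) * (k.factorial : ℝ)⁻¹ *
      ((k.choose j : ℝ) * E ^ (k - j)) * Real.exp (-lam * (y + x * V)) *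
      ((j.choose u : ℝ) * V ^ (j - u)) * (lam ^ p / (p.factorial : ℝ)) *
      ((p.choose t : ℝ)) * (z ^ z / Real.Gamma z) * G) * (Real.Gamma (y + j) / Real.Gamma (y + j)) := by ring
      _ = _ := by
        rw [hc, div_self hG]
        ring

/-! ### Distribution of the SIDNR of one hop -/

lemma measureReal_prod_eq_integral {α β : Type*} [MeasurableSpace α] [MeasurableSpace β]
    {μ : Measure α} {ν : Measure β} [IsFiniteMeasure μ] [IsFiniteMeasure ν] {A : Set (α × β)}
    (hA : MeasurableSet A) :
    (μ.prod ν).real A = ∫ x, ν.real (Prod.mk x ⁻¹' A) ∂μ := by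
  rw [measureReal_def, Measure.prod_apply hA]
  simp only [measureReal_def]
  exact (integral_toReal (measurable_measure_prodMk_left hA).aemeasurable
    (ae_of_all _ fun x => measure_lt_top _ _)).symm

/-- Physically meaningful parameters of a hop. -/
structure Hop.Valid (L : Hop) : Prop where
  power : 0 < L.power
  loss : 0 < L.loss
  lossPU : 0 < L.lossPU
  pbsPower : 0 < L.pbsPower
  pbsLoss : 0 < L.pbsLoss
  dist : 0 ≤ L.dist
  pbsDist : 0 ≤ L.pbsDist
  errVar : 0 ≤ L.errVar
  noise : 0 < L.noise
  itc : 0 < L.itc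
  x : 0 < L.x
  y : 0 < L.y
  z : 0 < L.z

lemma Hop.measurableSet_le_sidnr (L : Hop) (v I g : ℝ) :
    MeasurableSet {p : ℝ × ℝ × ℝ | g ≤ L.sidnr (L.txPower p.2.1) p.2.2 p.1 v I} := by
  refine measurableSet_le measurable_const ?_
  simp only [Hop.sidnr, Hop.txPower, Hop.pbsInterference, Hop.normNoise]
  fun_prop

namespace Hop.Valid

variable {L : Hop} (hL : L.Valid)
include hL

lemma errPower_nonneg : 0 ≤ L.errPower :=
  mul_nonneg hL.errVar (by linarith [hL.dist])

lemma pbsInterference_pos {q : ℝ} (hq : 0 < q) : 0 < L.pbsInterference q := by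
  have := hL.loss; have := hL.pbsPower; have := hL.pbsLoss; have := hL.pbsDist
  unfold Hop.pbsInterference
  positivity

lemma normNoise_pos {q : ℝ} (hq : 0 < q) : 0 < L.normNoise q :=
  div_pos hL.noise (mul_pos hq hL.loss)

lemma txPower_pos {Y : ℝ} (hY : 0 < Y) : 0 < L.txPower Y :=
  lt_min hL.power (div_pos hL.itc (mul_pos hL.lossPU hY))

lemma denom_pos {q X Z I : ℝ} (hq : 0 < q) (hX : 0 < X) (hZ : 0 ≤ Z) (hI : 0 ≤ I) :
    0 < X * I + X * L.dist + L.errPower + Z * L.pbsInterference q + L.normNoise q := by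
  have h1 := hL.errPower_nonneg
  have h2 := hL.pbsInterference_pos hq
  have h3 := hL.normNoise_pos hq
  have h4 := hL.dist
  positivity

lemma sidnr_nonneg {q X Z v I : ℝ} (hq : 0 < q) (hX : 0 < X) (hZ : 0 ≤ Z) (hv : 0 ≤ v)
    (hI : 0 ≤ I) : 0 ≤ L.sidnr q X Z v I :=
  div_nonneg (by positivity) (hL.denom_pos hq hX hZ hI).le

/-- Clearing the positive denominator makes the condition linear in `X`: it bounds `X` from below
when the coefficient is positive and fails for `g > 0` otherwise. -/
lemma le_sidnr_iff {q X Z v I g : ℝ} (hq : 0 < q) (hX : 0 < X) (hZ : 0 ≤ Z) (hI : 0 ≤ I) :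
    g ≤ L.sidnr q X Z v I ↔ g * (L.errPower + Z * L.pbsInterference q + L.normNoise q)
      ≤ X * (v - I * g - L.dist * g) := by
  rw [Hop.sidnr, le_div_iff₀ (hL.denom_pos hq hX hZ hI)]
  constructor <;> intro h <;> linarith

/-- Success probability of a hop, given the gains of the links to the primary user and from the
primary base station. -/
lemma real_le_sidnr {q Z v I g : ℝ} (hq : 0 < q) (hZ : 0 ≤ Z) (hI : 0 ≤ I) (hg : 0 < g) :
    (gammaMeasure L.x L.x).real {X | g ≤ L.sidnr q X Z v I}
      = if v - I * g - L.dist * g ≤ 0 then 0 else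
        erlangTail L.x L.x (g * (L.errPower + Z * L.pbsInterference q + L.normNoise q)
          / (v - I * g - L.dist * g)) := by
  have hx : (0 : ℝ) < L.x := by exact_mod_cast hL.x
  have hN : 0 < g * (L.errPower + Z * L.pbsInterference q + L.normNoise q) := by
    have h1 := hL.errPower_nonneg
    have h2 := hL.pbsInterference_pos hq
    have h3 := hL.normNoise_pos hq
    positivity
  split_ifs with hA
  · have : {X | g ≤ L.sidnr q X Z v I} =ᵐ[gammaMeasure L.x L.x] (∅ : Set ℝ) := by
      filter_upwards [ae_pos_gammaMeasure L.x L.x] with X hX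
      refine propext ⟨fun h => ?_, fun h => h.elim⟩
      have := (hL.le_sidnr_iff hq hX hZ hI).1 h
      nlinarith [mul_nonneg hX.le (neg_nonneg.2 hA)]
    rw [measureReal_congr this, measureReal_empty]
  · rw [not_le] at hA
    rw [← gammaMeasure_real_Ici hL.x hx (by positivity)]
    refine measureReal_congr ?_
    filter_upwards [ae_pos_gammaMeasure L.x L.x] with X hX
    refine propext ((hL.le_sidnr_iff hq hX hZ hI).trans ?_)
    change _ ↔ _ ≤ X
    rw [div_le_iff₀ hA]

/-- The distribution function of the SIDNR of a hop is given by the closed form. -/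
lemma real_coverage {v I g : ℝ} (hI : 0 ≤ I) (hg : 0 < g) :
    ((gammaMeasure L.z L.z).prod ((gammaMeasure L.y L.y).prod (gammaMeasure L.x L.x))).real
      {p | g ≤ L.sidnr (L.txPower p.2.1) p.2.2 p.1 v I} = 1 - L.cdfClosed v I g := by
  have hx : (0 : ℝ) < L.x := by exact_mod_cast hL.x
  have hy : (0 : ℝ) < L.y := by exact_mod_cast hL.y
  have hz := hL.z
  have hP := hL.power
  have hl := hL.loss
  have := isProbabilityMeasure_gammaMeasure hx hx
  have := isProbabilityMeasure_gammaMeasure hy hy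
  have := isProbabilityMeasure_gammaMeasure hz hz
  have hmeas := L.measurableSet_le_sidnr v I g
  -- `Z` is integrated last: `X` gives the survival function, and only the average over `Y` produces
  -- the negative powers behind the Meijer function.
  rw [measureReal_prod_eq_integral hmeas]
  have hsec : ∀ Z : ℝ, ((gammaMeasure L.y L.y).prod (gammaMeasure L.x L.x)).real
      (Prod.mk Z ⁻¹' {p : ℝ × ℝ × ℝ | g ≤ L.sidnr (L.txPower p.2.1) p.2.2 p.1 v I})
      = ∫ Y, (gammaMeasure L.x L.x).real {X | g ≤ L.sidnr (L.txPower Y) X Z v I}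
        ∂gammaMeasure L.y L.y := fun Z =>
    measureReal_prod_eq_integral (measurable_prodMk_left hmeas)
  simp only [hsec, Hop.cdfClosed]
  set A := v - I * g - L.dist * g with hAdef
  set T := L.itc / L.lossPU with hT
  have hTpos : 0 < T := div_pos hL.itc hL.lossPU
  split_ifs with hA
  · rw [sub_self]
    refine integral_eq_zero_of_ae ?_
    filter_upwards [ae_pos_gammaMeasure L.z L.z] with Z hZ
    refine integral_eq_zero_of_ae ?_
    filter_upwards [ae_pos_gammaMeasure L.y L.y] with Y hY
    rw [hL.real_le_sidnr (hL.txPower_pos hY) hZ.le hI hg, if_pos hA]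
    rfl
  · have hA' : 0 < A := not_le.1 hA
    set lam := T / L.power with hlamdef
    have hlam : 0 < lam := div_pos hTpos hP
    set cI := L.pbsInterference L.power * g / A with hcI
    set cE := L.errPower * g / A with hcE
    set cS := L.normNoise L.power * g / A with hcS
    set cV := L.normNoise T * g / A with hcV
    set cU := L.pbsInterference T * g / A with hcU
    have hcI0 : 0 < cI := div_pos (mul_pos (hL.pbsInterference_pos hP) hg) hA'
    have hcV0 : 0 < cV := div_pos (mul_pos (hL.normNoise_pos hTpos) hg) hA'
    have hcU0 : 0 < cU := div_pos (mul_pos (hL.pbsInterference_pos hTpos) hg) hA'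
    -- The interference constraint becomes active at `Y = lam`. Beyond it the power is `T / Y`, so
    -- normalized noise and interference are their values at power `T` multiplied by `Y`.
    have hY : ∀ Z : ℝ, 0 < Z → ∀ Y : ℝ, 0 < Y →
        (gammaMeasure L.x L.x).real {X | g ≤ L.sidnr (L.txPower Y) X Z v I}
        = if Y ≤ lam then erlangTail L.x L.x (cE + cS + Z * cI)
          else erlangTail L.x L.x (cE + Y * (cV + Z * cU)) := by
      intro Z hZ Y hY
      rw [hL.real_le_sidnr (hL.txPower_pos hY) hZ.le hI hg, if_neg hA]
      have hTY : L.itc / (L.lossPU * Y) = T / Y := by rw [hT, div_div]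
      split_ifs with h
      · have hq : L.txPower Y = L.power := by
          rw [Hop.txPower, hTY]
          refine min_eq_left ?_
          rw [hlamdef, le_div_iff₀ hP] at h
          rw [le_div_iff₀ hY]; linarith
        rw [hq]
        congr 1
        simp only [hcE, hcS, hcI, ← hAdef]
        field_simp
        ring
      · have hq : L.txPower Y = T / Y := by
          rw [Hop.txPower, hTY]
          refine min_eq_right ?_
          rw [not_le, hlamdef, div_lt_iff₀ hP] at h
          rw [div_le_iff₀ hY]; linarith
        rw [hq]
        congr 1
        simp only [hcE, hcV, hcU, ← hAdef, Hop.pbsInterference, Hop.normNoise]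
        field_simp
        ring
    have hZ := ((hasInt_erlangTail_interference L.x hz hcI0.le (cE + cS)).const_mul
      (lowerGamma L.y (L.y * lam) / Real.Gamma L.y)).add
      (hasInt_meijer_sum (E := cE) hL.x hL.y hz hcV0.le hcU0 hlam.le)
    -- The incomplete gamma terms outside the averages sum to one, so `1 - F` is just the two
    -- averages.
    have hup : upperGamma L.y (L.y * lam) / Real.Gamma L.y
        = 1 - lowerGamma L.y (L.y * lam) / Real.Gamma L.y := by
      have hG : Real.Gamma L.y ≠ 0 := (Real.Gamma_pos_of_pos hy).ne'
      rw [eq_sub_iff_add_eq, ← add_div, add_comm,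
        lowerGamma_add_upperGamma hy (by positivity), div_self hG]
    refine (integral_congr_ae ?_).trans (hZ.integral_eq.trans ?_)
    · filter_upwards [ae_pos_gammaMeasure L.z L.z] with Z hZpos
      rw [← (hasInt_erlangTail_txPower L.x hL.y (cE + cS + Z * cI) cE
        (by positivity : 0 ≤ cV + Z * cU) hlam.le).integral_eq]
      refine integral_congr_ae ?_
      filter_upwards [ae_pos_gammaMeasure L.y L.y] with Y hYpos
      exact hY Z hZpos Y hYpos
    · rw [hup]
      ring

end Hop.Valid

/-! ### Independence of the gains of the two hops -/

/-- The order of the triple is reversed to match the order of integration, interference gain first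
and link gain last. -/
lemma iIndepFun.hasLaw_triple {Ω ι : Type*} [MeasurableSpace Ω] {μ : Measure Ω}
    [IsProbabilityMeasure μ] {f : ι → Ω → ℝ} (hf : iIndepFun f μ)
    (hm : ∀ i, AEMeasurable (f i) μ) {i j k : ι} (hij : i ≠ j) (hik : i ≠ k) (hjk : j ≠ k)
    {νi νj νk : Measure ℝ} (hi : HasLaw (f i) νi μ) (hj : HasLaw (f j) νj μ)
    (hk : HasLaw (f k) νk μ) :
    HasLaw (fun ω => (f k ω, f j ω, f i ω)) (νk.prod (νj.prod νi)) μ := by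
  refine ⟨(hm k).prodMk ((hm j).prodMk (hm i)), ?_⟩
  have h1 := (hf.indepFun hij.symm).map_prod_eq_prod_map_map (hm j) (hm i)
  have h2 := (hf.indepFun_prodMk₀ hm j i k hjk hik).symm.map_prod_eq_prod_map_map (hm k)
    ((hm j).prodMk (hm i))
  rw [h2, h1, hi.map_eq, hj.map_eq, hk.map_eq]

lemma iIndepFun.indepFun_triple {Ω : Type*} [MeasurableSpace Ω] {μ : Measure Ω}
    {f : Fin 6 → Ω → ℝ} (hf : iIndepFun f μ) (hm : ∀ i, AEMeasurable (f i) μ) :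
    IndepFun (fun ω => (f 2 ω, f 1 ω, f 0 ω)) (fun ω => (f 5 ω, f 4 ω, f 3 ω)) μ := by
  have h := hf.indepFun_finset₀ {0, 1, 2} {3, 4, 5} (by decide) hm
  exact h.comp
    (φ := fun p : (({0, 1, 2} : Finset (Fin 6)) → ℝ) =>
      (p ⟨2, by decide⟩, p ⟨1, by decide⟩, p ⟨0, by decide⟩))
    (ψ := fun p : (({3, 4, 5} : Finset (Fin 6)) → ℝ) =>
      (p ⟨5, by decide⟩, p ⟨4, by decide⟩, p ⟨3, by decide⟩)) (by fun_prop) (by fun_prop)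

lemma le_mul_logb_iff {c R g : ℝ} (hc : 0 < c) (hg : 0 ≤ g) :
    R ≤ c * Real.logb 2 (1 + g) ↔ (2 : ℝ) ^ (R / c) - 1 ≤ g := by
  rw [← div_le_iff₀' hc, Real.le_logb_iff_rpow_le one_lt_two (by linarith), sub_le_iff_le_add']

/-! ### Closed-form power factors -/

lemma mul_sum_Ico_pow (g : ℝ) {a b : ℕ} (hab : a ≤ b) :
    g * ∑ m ∈ Finset.Ico a b, (1 + g) ^ (b - m - 1) = (1 + g) ^ (b - a) - 1 := by
  rw [Finset.sum_Ico_eq_sum_range, Finset.mul_sum]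
  have h := mul_geom_sum (1 + g) (b - a)
  rw [← h, ← Finset.sum_range_reflect, Finset.mul_sum]
  refine Finset.sum_congr rfl fun m hm => ?_
  have hm := Finset.mem_range.1 hm
  rw [show b - (a + (b - a - 1 - m)) - 1 = m by omega]
  ring

namespace Network

variable {C : ℕ}

lemma sum_Ioi_fin_eq (n : Fin C) (f : ℕ → ℝ) :
    ∑ m ∈ Finset.Ioi n, f m = ∑ m ∈ Finset.Ico ((n : ℕ) + 1) C, f m := by
  have h : Finset.Ico ((n : ℕ) + 1) C = (Finset.Ioi n).map Fin.valEmbedding := by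
    ext k
    simp only [Finset.mem_Ico, Finset.mem_map, Finset.mem_Ioi, Fin.valEmbedding_apply]
    constructor
    · rintro ⟨h1, h2⟩
      exact ⟨⟨k, h2⟩, by rw [Fin.lt_def]; exact h1, rfl⟩
    · rintro ⟨m, h1, rfl⟩
      exact ⟨h1, m.2⟩
  rw [h, Finset.sum_map]; rfl

lemma sum_Ioo_fin_eq (n j : Fin C) (f : ℕ → ℝ) :
    ∑ m ∈ Finset.Ioo n j, f m = ∑ m ∈ Finset.Ico ((n : ℕ) + 1) j, f m := by
  have h : Finset.Ico ((n : ℕ) + 1) j = (Finset.Ioo n j).map Fin.valEmbedding := by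
    ext k
    simp only [Finset.mem_Ico, Finset.mem_map, Finset.mem_Ioo, Fin.valEmbedding_apply]
    constructor
    · rintro ⟨h1, h2⟩
      exact ⟨⟨k, h2.trans j.2⟩, ⟨by rw [Fin.lt_def]; exact h1, by rw [Fin.lt_def]; exact h2⟩, rfl⟩
    · rintro ⟨m, ⟨h1, h2⟩, rfl⟩
      exact ⟨h1, h2⟩
  rw [h, Finset.sum_map]; rfl

/-- Power factors that satisfy the SIDNR constraints dominate those that meet them with equality. -/
lemma le_of_sic_le {N v c : Fin C → ℝ} {g : ℝ} (hg : 0 ≤ g) (hc : ∀ n, c n = g * (sic c n + N n))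
    (hv : ∀ n, g * (sic v n + N n) ≤ v n) (n : Fin C) : c n ≤ v n := by
  -- Induction runs downward from the last user, since SIC interference involves only later users.
  induction n using (wellFounded_gt (α := Fin C)).induction with
  | _ n ih =>
    rw [hc n]
    refine le_trans (mul_le_mul_of_nonneg_left ?_ hg) (hv n)
    exact add_le_add_left (Finset.sum_le_sum fun m hm => ih m (Finset.mem_Ioi.1 hm)) _

variable (net : Network C) (h : Gains C)

lemma alphaClosed_eq (g : ℝ) (n : Fin C) :
    net.alphaClosed h g n = g * (sic (net.alphaClosed h g) n + net.noiseS h) := by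
  have h1 : sic (net.alphaClosed h g) n = net.noiseS h * ((1 + g) ^ (C - 1 - (n : ℕ)) - 1) := by
    simp only [sic, alphaClosed]
    rw [sum_Ioi_fin_eq n (fun m => net.noiseS h * g * (1 + g) ^ (C - 1 - m)), ← Finset.mul_sum,
      mul_assoc]
    have := mul_sum_Ico_pow g (show (n : ℕ) + 1 ≤ C by omega)
    rw [show C - 1 - (n : ℕ) = C - (n + 1) by omega, ← this]
    refine congrArg _ (congrArg _ (Finset.sum_congr rfl fun m _ => ?_))
    rw [show C - 1 - m = C - m - 1 by omega]
  rw [h1, alphaClosed]; ring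

/-- In the interference on user `n`, the noise of a later user `j` has coefficient `g` from its own
factor plus `g²` times a geometric sum over the users strictly between; together these are `g (1 +
g)^(j-n-1)`. -/
lemma betaClosed_eq (g : ℝ) (n : Fin C) :
    net.betaClosed h g n = g * (sic (net.betaClosed h g) n + net.noiseTermR h n) := by
  have h1 : sic (net.betaClosed h g) n
      = g * ∑ j ∈ Finset.Ioi n, net.noiseTermR h j * (1 + g) ^ ((j : ℕ) - (n : ℕ) - 1) := by
    simp only [sic, betaClosed]
    rw [Finset.sum_add_distrib, ← Finset.mul_sum]
    have h2 : ∑ m ∈ Finset.Ioi n, ∑ j ∈ Finset.Ioi m,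
        net.noiseTermR h j * (1 + g) ^ ((j : ℕ) - (m : ℕ) - 1)
        = ∑ j ∈ Finset.Ioi n, ∑ m ∈ Finset.Ioo n j,
          net.noiseTermR h j * (1 + g) ^ ((j : ℕ) - (m : ℕ) - 1) := by
      refine Finset.sum_comm' fun m j => ?_
      simp only [Finset.mem_Ioi, Finset.mem_Ioo]
      exact ⟨fun hh => ⟨hh, hh.1.trans hh.2⟩, fun hh => hh.1⟩
    rw [h2, pow_two, mul_assoc, Finset.mul_sum, Finset.mul_sum, Finset.mul_sum, ← Finset.sum_add_distrib]
    refine Finset.sum_congr rfl fun j hj => ?_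
    have hnj : (n : ℕ) + 1 ≤ j := Finset.mem_Ioi.1 hj
    rw [← Finset.mul_sum, sum_Ioo_fin_eq n j (fun m => (1 + g) ^ ((j : ℕ) - m - 1)),
      mul_left_comm g (net.noiseTermR h j), mul_sum_Ico_pow g hnj,
      show (j : ℕ) - n - 1 = j - (n + 1) by omega]
    ring
  rw [h1, betaClosed]; ring

lemma sum_alphaClosed (g : ℝ) :
    ∑ n, net.alphaClosed h g n = net.noiseS h * ((1 + g) ^ C - 1) := by
  simp only [alphaClosed]
  rw [Fin.sum_univ_eq_sum_range (fun m => net.noiseS h * g * (1 + g) ^ (C - 1 - m)),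
    ← Finset.mul_sum, mul_assoc]
  have := mul_sum_Ico_pow g (Nat.zero_le C)
  rw [tsub_zero] at this
  rw [Finset.range_eq_Ico, ← this]
  refine congrArg _ (congrArg _ (Finset.sum_congr rfl fun m _ => ?_))
  rw [show C - 1 - m = C - m - 1 by omega]

end Network

/-! ### Optimal power control -/

lemma Hop.Valid.noiseTerm_pos {L : Hop} (hL : L.Valid) {X Z : ℝ} (hX : 0 < X) (hZ : 0 ≤ Z) :
    0 < L.noiseTerm X Z := by
  have h1 := hL.errPower_nonneg
  have h2 := hL.pbsInterference_pos hL.power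
  have h3 := hL.normNoise_pos hL.power
  have h4 := hL.dist
  unfold Hop.noiseTerm
  positivity

lemma Hop.sidnr_power (L : Hop) {X : ℝ} (hX : 0 < X) (Z v I : ℝ) :
    L.sidnr L.power X Z v I = v / (I + L.noiseTerm X Z) := by
  have : X * I + X * L.dist + L.errPower + Z * L.pbsInterference L.power + L.normNoise L.power
      = X * (I + L.noiseTerm X Z) := by
    unfold Hop.noiseTerm
    field_simp
    ring
  rw [Hop.sidnr, this, mul_div_mul_left _ _ hX.ne']

namespace Network

variable {C : ℕ} {net : Network C} {h : Gains C}

lemma Valid.hopS (hnet : net.Valid) : net.hopS.Valid where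
  power := hnet.powerS
  loss := hnet.lossSR
  lossPU := hnet.lossSK
  pbsPower := hnet.powerP
  pbsLoss := hnet.lossPR
  dist := hnet.distSR
  pbsDist := hnet.distPR
  errVar := hnet.errVarSR
  noise := hnet.noiseR
  itc := hnet.itc
  x := hnet.mSR
  y := hnet.mSK
  z := hnet.mPR

lemma Valid.hopR (hnet : net.Valid) (n : Fin C) : (net.hopR n).Valid where
  power := hnet.powerR
  loss := hnet.lossRN n
  lossPU := hnet.lossRK
  pbsPower := hnet.powerP
  pbsLoss := hnet.lossPN n
  dist := hnet.distRN n
  pbsDist := hnet.distPN n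
  errVar := hnet.errVarRN n
  noise := hnet.noiseN n
  itc := hnet.itc
  x := hnet.mRN n
  y := hnet.mRK
  z := hnet.mPN n

lemma Valid.noiseS_pos (hnet : net.Valid) (hh : h.Valid) : 0 < net.noiseS h :=
  hnet.hopS.noiseTerm_pos hh.SR hh.PR

lemma Valid.noiseTermR_pos (hnet : net.Valid) (hh : h.Valid) (n : Fin C) : 0 < net.noiseTermR h n :=
  (hnet.hopR n).noiseTerm_pos (hh.RN n) (hh.PN n)

lemma Valid.budgetS_pos (hnet : net.Valid) (hh : h.Valid) : 0 < net.budgetS h :=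
  lt_min one_pos (div_pos hnet.itc (mul_pos hnet.powerS (mul_pos hnet.lossSK hh.SK)))

lemma Valid.budgetR_pos (hnet : net.Valid) (hh : h.Valid) : 0 < net.budgetR h :=
  lt_min one_pos (div_pos hnet.itc (mul_pos hnet.powerR (mul_pos hnet.lossRK hh.RK)))

lemma sidnrS_eq (hh : h.Valid) (α : Fin C → ℝ) (n : Fin C) :
    net.sidnrS net.powerS h α n = α n / (sic α n + net.noiseS h) :=
  net.hopS.sidnr_power hh.SR _ _ _

lemma sidnrR_eq (hh : h.Valid) (β : Fin C → ℝ) (n : Fin C) :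
    net.sidnrR net.powerR h β n = β n / (sic β n + net.noiseTermR h n) :=
  (net.hopR n).sidnr_power (hh.RN n) _ _ _

lemma sic_nonneg {v : Fin C → ℝ} (hv : ∀ n, 0 ≤ v n) (n : Fin C) : 0 ≤ sic v n :=
  Finset.sum_nonneg fun m _ => hv m

lemma Valid.alphaClosed_nonneg (hnet : net.Valid) (hh : h.Valid) {g : ℝ} (hg : 0 ≤ g) (n : Fin C) :
    0 ≤ net.alphaClosed h g n := by
  have := hnet.noiseS_pos hh
  unfold alphaClosed; positivity

lemma Valid.betaClosed_nonneg (hnet : net.Valid) (hh : h.Valid) {g : ℝ} (hg : 0 ≤ g) (n : Fin C) :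
    0 ≤ net.betaClosed h g n := by
  have := hnet.noiseTermR_pos hh
  have h2 : 0 ≤ ∑ j ∈ Finset.Ioi n, net.noiseTermR h j * (1 + g) ^ ((j : ℕ) - (n : ℕ) - 1) :=
    Finset.sum_nonneg fun j _ => mul_nonneg (this j).le (by positivity)
  have := this n
  unfold betaClosed; positivity

lemma Valid.sidnrS_alphaClosed (hnet : net.Valid) (hh : h.Valid) {g : ℝ} (hg : 0 ≤ g) (n : Fin C) :
    net.sidnrS net.powerS h (net.alphaClosed h g) n = g := by
  have h1 := hnet.noiseS_pos hh
  have h2 := sic_nonneg (hnet.alphaClosed_nonneg hh hg) n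
  rw [sidnrS_eq hh, div_eq_iff (by positivity)]
  exact net.alphaClosed_eq h g n

lemma Valid.sidnrR_betaClosed (hnet : net.Valid) (hh : h.Valid) {g : ℝ} (hg : 0 ≤ g) (n : Fin C) :
    net.sidnrR net.powerR h (net.betaClosed h g) n = g := by
  have h1 := hnet.noiseTermR_pos hh n
  have h2 := sic_nonneg (hnet.betaClosed_nonneg hh hg) n
  rw [sidnrR_eq hh, div_eq_iff (by positivity)]
  exact net.betaClosed_eq h g n

lemma Valid.sum_alphaClosed_strictMono (hnet : net.Valid) (hh : h.Valid) (hC : 0 < C) :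
    StrictMonoOn (fun g => ∑ n, net.alphaClosed h g n) (Ici 0) := by
  intro a ha b _ hab
  have ha : 0 ≤ a := ha
  have h1 := hnet.noiseS_pos hh
  simp only [sum_alphaClosed]
  have : (1 + a) ^ C < (1 + b) ^ C := pow_lt_pow_left₀ (by linarith) (by linarith) hC.ne'
  nlinarith

lemma Valid.sum_betaClosed_strictMono (hnet : net.Valid) (hh : h.Valid) (hC : 0 < C) :
    StrictMonoOn (fun g => ∑ n, net.betaClosed h g n) (Ici 0) := by
  intro a ha b _ hab
  have ha : 0 ≤ a := ha
  have h1 := hnet.noiseTermR_pos hh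
  refine Finset.sum_lt_sum_of_nonempty ⟨⟨0, hC⟩, Finset.mem_univ _⟩ fun n _ => ?_
  refine add_lt_add_of_lt_of_le (mul_lt_mul_of_pos_left hab (h1 n)) ?_
  refine mul_le_mul (by gcongr) (Finset.sum_le_sum fun j _ => ?_)
    (Finset.sum_nonneg fun j _ => mul_nonneg (h1 j).le (by positivity)) (by positivity)
  exact mul_le_mul_of_nonneg_left (by gcongr) (h1 j).le

lemma Valid.exists_sum_betaClosed (hnet : net.Valid) (hh : h.Valid) (hC : 0 < C) {Φ : ℝ} (hΦ : 0 < Φ) :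
    ∃ g, 0 < g ∧ ∑ n, net.betaClosed h g n = Φ := by
  have h1 := hnet.noiseTermR_pos hh
  have hcont : Continuous (fun g => ∑ n, net.betaClosed h g n) := by
    unfold betaClosed; fun_prop
  set i : Fin C := ⟨0, hC⟩
  -- At `M` the noise part of the first user's factor alone already equals `Φ`, an upper end for the
  -- intermediate value theorem.
  set M := Φ / net.noiseTermR h i with hM
  have hM0 : 0 < M := div_pos hΦ (h1 i)
  have h0 : ∑ n, net.betaClosed h 0 n = 0 := by simp [betaClosed]
  have hMge : Φ ≤ ∑ n, net.betaClosed h M n := by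
    refine le_trans ?_ (Finset.single_le_sum (fun n _ => hnet.betaClosed_nonneg hh hM0.le n)
      (Finset.mem_univ i))
    have h2 : net.noiseTermR h i * M = Φ := mul_div_cancel₀ _ (h1 i).ne'
    unfold betaClosed
    rw [h2]
    refine le_add_of_nonneg_right (mul_nonneg (by positivity) (Finset.sum_nonneg fun j _ => ?_))
    exact mul_nonneg (h1 j).le (by positivity)
  obtain ⟨g, hg, hgΦ⟩ := intermediate_value_Icc hM0.le hcont.continuousOn
    (show Φ ∈ Icc (∑ n, net.betaClosed h 0 n) _ from ⟨by rw [h0]; exact hΦ.le, hMge⟩)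
  refine ⟨g, lt_of_le_of_ne hg.1 ?_, hgΦ⟩
  rintro rfl
  simp only [h0] at hgΦ
  exact hΦ.ne hgΦ

/-- Feasible power factors dominate those of the closed form. -/
lemma Valid.closed_le_of_feasible (hnet : net.Valid) (hh : h.Valid) {α β : Fin C → ℝ} {g : ℝ}
    (hf : net.Feasible h α β g) :
    (∀ n, net.alphaClosed h g n ≤ α n) ∧ ∀ n, net.betaClosed h g n ≤ β n := by
  constructor
  · refine le_of_sic_le hf.nonneg (net.alphaClosed_eq h g) fun n => ?_
    have h1 := (hf.sidnr n).trans (min_le_left _ _)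
    have h2 := sic_nonneg (fun n => (hf.memS n).1) n
    have h3 := hnet.noiseS_pos hh
    rwa [sidnrS_eq hh, le_div_iff₀ (by positivity)] at h1
  · refine le_of_sic_le hf.nonneg (net.betaClosed_eq h g) fun n => ?_
    have h1 := (hf.sidnr n).trans (min_le_right _ _)
    have h2 := sic_nonneg (fun n => (hf.memR n).1) n
    have h3 := hnet.noiseTermR_pos hh n
    rwa [sidnrR_eq hh, le_div_iff₀ (by positivity)] at h1

lemma Valid.feasible_closed (hnet : net.Valid) (hh : h.Valid) {g : ℝ} (hg : 0 ≤ g)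
    (hS : ∑ n, net.alphaClosed h g n ≤ net.budgetS h)
    (hR : ∑ n, net.betaClosed h g n ≤ net.budgetR h) :
    net.Feasible h (net.alphaClosed h g) (net.betaClosed h g) g where
  sidnr n := by rw [hnet.sidnrS_alphaClosed hh hg, hnet.sidnrR_betaClosed hh hg, min_self]
  sumS := hS
  sumR := hR
  memS n := ⟨hnet.alphaClosed_nonneg hh hg n,
    (Finset.single_le_sum (fun m _ => hnet.alphaClosed_nonneg hh hg m) (Finset.mem_univ n)).trans
      (hS.trans (min_le_left _ _))⟩
  memR n := ⟨hnet.betaClosed_nonneg hh hg n,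
    (Finset.single_le_sum (fun m _ => hnet.betaClosed_nonneg hh hg m) (Finset.mem_univ n)).trans
      (hR.trans (min_le_left _ _))⟩
  nonneg := hg

/-- The closed-form allocation is the unique least-energy solution of the power control problem. -/
lemma Valid.isOptimalPower_iff (hnet : net.Valid) (hh : h.Valid) (hC : 0 < C) {gS gR : ℝ}
    (hgS : 0 ≤ gS) (hgR : 0 ≤ gR) (hS : ∑ n, net.alphaClosed h gS n = net.budgetS h)
    (hR : ∑ n, net.betaClosed h gR n = net.budgetR h) (α β : Fin C → ℝ) (g : ℝ) :
    net.IsOptimalPower h α β g ↔ α = net.alphaClosed h (min gS gR) ∧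
      β = net.betaClosed h (min gS gR) ∧ g = min gS gR := by
  have hm : 0 ≤ min gS gR := le_min hgS hgR
  have hSm := hnet.sum_alphaClosed_strictMono hh hC
  have hRm := hnet.sum_betaClosed_strictMono hh hC
  have hfeas : net.Feasible h (net.alphaClosed h (min gS gR)) (net.betaClosed h (min gS gR))
      (min gS gR) :=
    hnet.feasible_closed hh hm
      (hS ▸ hSm.monotoneOn hm hgS (min_le_left _ _)) (hR ▸ hRm.monotoneOn hm hgR (min_le_right _ _))
  have hmax : ∀ α' β' g', net.Feasible h α' β' g' → g' ≤ min gS gR := by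
    intro α' β' g' hf
    obtain ⟨h1, h2⟩ := hnet.closed_le_of_feasible hh hf
    refine le_min ((hSm.le_iff_le hf.nonneg hgS).1 ?_) ((hRm.le_iff_le hf.nonneg hgR).1 ?_)
    · exact (Finset.sum_le_sum fun n _ => h1 n).trans (hf.sumS.trans_eq hS.symm)
    · exact (Finset.sum_le_sum fun n _ => h2 n).trans (hf.sumR.trans_eq hR.symm)
  constructor
  · intro ho
    obtain rfl : g = min gS gR :=
      le_antisymm (hmax _ _ _ ho.feasible) (ho.max_min _ _ _ hfeas)
    obtain ⟨h1, h2⟩ := hnet.closed_le_of_feasible hh ho.feasible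
    have hs1 := Finset.sum_le_sum fun n (_ : n ∈ Finset.univ) => h1 n
    have hs2 := Finset.sum_le_sum fun n (_ : n ∈ Finset.univ) => h2 n
    -- Least energy reverses the domination of the totals, so both sums agree, and hence so do all
    -- components.
    have he := ho.least_energy _ _ hfeas
    refine ⟨funext fun n => ?_, funext fun n => ?_, rfl⟩
    · exact ((Finset.sum_eq_sum_iff_of_le fun n _ => h1 n).1 (by linarith) n (Finset.mem_univ n)).symm
    · exact ((Finset.sum_eq_sum_iff_of_le fun n _ => h2 n).1 (by linarith) n (Finset.mem_univ n)).symm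
  · rintro ⟨rfl, rfl, rfl⟩
    refine ⟨hfeas, hmax, fun α' β' hf => ?_⟩
    obtain ⟨h1, h2⟩ := hnet.closed_le_of_feasible hh hf
    exact add_le_add (Finset.sum_le_sum fun n _ => h1 n) (Finset.sum_le_sum fun n _ => h2 n)

lemma Valid.sum_alphaClosed_root (hnet : net.Valid) (hh : h.Valid) (hC : 0 < C) :
    0 < (net.budgetS h / net.noiseS h + 1) ^ (1 / (C : ℝ)) - 1 ∧
    ∑ n, net.alphaClosed h ((net.budgetS h / net.noiseS h + 1) ^ (1 / (C : ℝ)) - 1) n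
      = net.budgetS h := by
  have h1 := hnet.noiseS_pos hh
  have h2 := hnet.budgetS_pos hh
  have h3 : 0 < net.budgetS h / net.noiseS h := by positivity
  have hC' : (0 : ℝ) < C := by exact_mod_cast hC
  constructor
  · have := Real.one_lt_rpow (by linarith : 1 < net.budgetS h / net.noiseS h + 1)
      (by positivity : 0 < 1 / (C : ℝ))
    linarith
  · rw [sum_alphaClosed, add_sub_cancel, ← Real.rpow_natCast, ← Real.rpow_mul (by positivity),
      one_div_mul_cancel hC'.ne', Real.rpow_one]
    field_simp
    ring

/-- For two users the total is `I₂ g² + (I₁ + I₂) g`; completing the square turns the radicand into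
`(2 I₂ g + I₁ + I₂)²`, and positivity selects the root. -/
lemma Valid.two_users (hnet : net.Valid) (hh : h.Valid) (hC2 : C = 2) {i₁ i₂ : Fin C}
    (hi₁ : (i₁ : ℕ) = 0) (hi₂ : (i₂ : ℕ) = 1) {g : ℝ} (hg : 0 < g)
    (hR : ∑ n, net.betaClosed h g n = net.budgetR h) :
    g = (√(4 * net.noiseTermR h i₂ * net.budgetR h
        + (net.noiseTermR h i₁ + net.noiseTermR h i₂) ^ 2)
        - net.noiseTermR h i₁ - net.noiseTermR h i₂) / (2 * net.noiseTermR h i₂) := by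
  subst hC2
  obtain rfl : i₁ = 0 := Fin.ext hi₁
  obtain rfl : i₂ = 1 := Fin.ext hi₂
  have h0 := hnet.noiseTermR_pos hh 0
  have h1 := hnet.noiseTermR_pos hh 1
  have e0 : Finset.Ioi (0 : Fin 2) = {1} := by decide
  have e1 : Finset.Ioi (1 : Fin 2) = ∅ := by decide
  have hb : net.budgetR h = net.noiseTermR h 1 * g ^ 2
      + (net.noiseTermR h 0 + net.noiseTermR h 1) * g := by
    rw [← hR, Fin.sum_univ_two]
    simp [betaClosed, e0, e1]
    ring
  have hsq : 4 * net.noiseTermR h 1 * net.budgetR h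
        + (net.noiseTermR h 0 + net.noiseTermR h 1) ^ 2
      = (2 * net.noiseTermR h 1 * g + net.noiseTermR h 0 + net.noiseTermR h 1) ^ 2 := by
    rw [hb]; ring
  rw [hsq, Real.sqrt_sq (by positivity)]
  field_simp
  ring

/-! ### Optimal phase time -/

/-- With equal SIDNRs in both phases, equal phase times are the unique optimum. -/
lemma Valid.isOptimalTime_iff (hnet : net.Valid) (hC : 0 < C) {α β : Fin C → ℝ} {g : ℝ} (hg : 0 < g)
    (hs : ∀ n, net.sidnrS net.powerS h α n = g ∧ net.sidnrR net.powerR h β n = g) :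
    (∀ lam, net.IsOptimalTime h α β lam ↔ lam = 1 / 2) ∧
      (∀ n, net.userRate h α β (1 / 2) n = net.bandwidth / 2 * Real.logb 2 (1 + g)) ∧
      net.clusterRate h α β (1 / 2) = net.bandwidth / 2 * Real.logb 2 (1 + g) := by
  have : Nonempty (Fin C) := ⟨⟨0, hC⟩⟩
  set l := Real.logb 2 (1 + g) with hl
  have hl0 : 0 < net.bandwidth * l :=
    mul_pos hnet.bandwidth (Real.logb_pos one_lt_two (by linarith))
  have hu : ∀ lam n, net.userRate h α β lam n
      = min (lam * (net.bandwidth * l)) ((1 - lam) * (net.bandwidth * l)) := by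
    intro lam n
    rw [userRate, rate, (hs n).1, (hs n).2, ← hl, mul_assoc, mul_assoc]
  have hc : ∀ lam, net.clusterRate h α β lam
      = min (lam * (net.bandwidth * l)) ((1 - lam) * (net.bandwidth * l)) := by
    intro lam
    simp only [clusterRate, hu, ciInf_const]
  have hhalf : min (1 / 2 * (net.bandwidth * l)) ((1 - 1 / 2) * (net.bandwidth * l))
      = net.bandwidth / 2 * l := by
    norm_num; ring
  refine ⟨fun lam => ⟨fun ho => ?_, ?_⟩, fun n => by rw [hu, hhalf], by rw [hc, hhalf]⟩
  -- An optimal `lam` does at least as well as `1 / 2`; the two terms of the minimum then give `lam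
  -- ≥ 1 / 2` and `1 - lam ≥ 1 / 2`.
  · have h1 := ho.2 (1 / 2) ⟨by norm_num, by norm_num⟩
    rw [hc, hc, hhalf, le_min_iff] at h1
    obtain ⟨h1, h2⟩ := h1
    refine le_antisymm ?_ ?_
    · by_contra hlt; nlinarith
    · by_contra hlt; nlinarith
  · rintro rfl
    refine ⟨⟨by norm_num, by norm_num⟩, fun lam _ => ?_⟩
    rw [hc, hc, hhalf]
    rcases le_total lam (1 / 2) with hle | hle
    · exact (min_le_left _ _).trans (by nlinarith)
    · exact (min_le_right _ _).trans (by nlinarith)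

/-! ### Coverage probability and the main theorem -/

variable {Ω : Type*} [MeasurableSpace Ω]

/-- Under independent Nakagami fading the coverage probability of a user is given by the closed
form. -/
lemma Valid.coverage_eq_coverageClosed (hnet : net.Valid) {μ : Measure Ω} [IsProbabilityMeasure μ]
    {H : Ω → Gains C} (hH : net.IsNakagami H μ) {Rbar lam : ℝ} (hR : 0 < Rbar) {α β : Fin C → ℝ}
    (hα : ∀ n, 0 ≤ α n) (hβ : ∀ n, 0 ≤ β n) (hlam0 : 0 < lam) (hlam1 : lam < 1) (n : Fin C) :
    net.coverage H μ Rbar α β lam n = net.coverageClosed Rbar α β lam n := by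
  have hW := hnet.bandwidth
  have hcS : 0 < lam * net.bandwidth := mul_pos hlam0 hW
  have hcR : 0 < (1 - lam) * net.bandwidth := mul_pos (by linarith) hW
  have hgS : 0 < net.thresholdS Rbar lam := by
    have := Real.one_lt_rpow one_lt_two (div_pos hR hcS)
    unfold thresholdS; linarith
  have hgR : 0 < net.thresholdR Rbar lam := by
    have := Real.one_lt_rpow one_lt_two (div_pos hR hcR)
    unfold thresholdR; linarith
  set f : Fin 6 → Ω → ℝ := ![fun ω => (H ω).SR, fun ω => (H ω).SK, fun ω => (H ω).PR,
    fun ω => (H ω).RN n, fun ω => (H ω).RK, fun ω => (H ω).PN n] with hf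
  have hind : iIndepFun f μ := hH.indep n
  have hm : ∀ i, AEMeasurable (f i) μ := by
    intro i
    fin_cases i
    exacts [hH.lawSR.aemeasurable, hH.lawSK.aemeasurable, hH.lawPR.aemeasurable,
      (hH.lawRN n).aemeasurable, hH.lawRK.aemeasurable, (hH.lawPN n).aemeasurable]
  have hlawS : HasLaw (fun ω => ((H ω).PR, (H ω).SK, (H ω).SR)) _ μ :=
    iIndepFun.hasLaw_triple hind hm (i := 0) (j := 1) (k := 2) (by decide) (by decide) (by decide)
      hH.lawSR hH.lawSK hH.lawPR
  have hlawR : HasLaw (fun ω => ((H ω).PN n, (H ω).RK, (H ω).RN n)) _ μ :=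
    iIndepFun.hasLaw_triple hind hm (i := 3) (j := 4) (k := 5) (by decide) (by decide) (by decide)
      (hH.lawRN n) hH.lawRK (hH.lawPN n)
  have hpair : IndepFun (fun ω => ((H ω).PR, (H ω).SK, (H ω).SR))
      (fun ω => ((H ω).PN n, (H ω).RK, (H ω).RN n)) μ := iIndepFun.indepFun_triple hind hm
  set AS : Set (ℝ × ℝ × ℝ) := {p | net.thresholdS Rbar lam
    ≤ net.hopS.sidnr (net.hopS.txPower p.2.1) p.2.2 p.1 (α n) (sic α n)} with hAS
  set AR : Set (ℝ × ℝ × ℝ) := {p | net.thresholdR Rbar lam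
    ≤ (net.hopR n).sidnr ((net.hopR n).txPower p.2.1) p.2.2 p.1 (β n) (sic β n)} with hAR
  have hASm : MeasurableSet AS := Hop.measurableSet_le_sidnr _ _ _ _
  have hARm : MeasurableSet AR := Hop.measurableSet_le_sidnr _ _ _ _
  have hpos : ∀ {X : Ω → ℝ} {a r : ℝ}, HasLaw X (gammaMeasure a r) μ → ∀ᵐ ω ∂μ, 0 < X ω := by
    intro X a r hX
    exact (hX.ae_iff (p := fun t => 0 < t) (measurableSet_setOfPred.1 measurableSet_Ioi)).2
      (ae_pos_gammaMeasure a r)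
  -- Rate thresholds translate into SIDNR thresholds only where the gains are positive, hence almost
  -- surely; the minimum in the rate becomes an intersection.
  have hev : {ω | Rbar ≤ net.fadingRate (H ω) α β lam n} =ᵐ[μ]
      ((fun ω => ((H ω).PR, (H ω).SK, (H ω).SR)) ⁻¹' AS ∩
        (fun ω => ((H ω).PN n, (H ω).RK, (H ω).RN n)) ⁻¹' AR : Set Ω) := by
    filter_upwards [hpos hH.lawSR, hpos hH.lawSK, hpos hH.lawPR, hpos (hH.lawRN n), hpos hH.lawRK,
      hpos (hH.lawPN n)] with ω h1 h2 h3 h4 h5 h6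
    have hS0 := hnet.hopS.sidnr_nonneg (hnet.hopS.txPower_pos h2) h1 h3.le (hα n) (sic_nonneg hα n)
    have hR0 := (hnet.hopR n).sidnr_nonneg ((hnet.hopR n).txPower_pos h5) h4 h6.le (hβ n)
      (sic_nonneg hβ n)
    refine propext (le_min_iff.trans (and_congr ?_ ?_))
    · exact le_mul_logb_iff hcS hS0
    · exact le_mul_logb_iff hcR hR0
  rw [coverage, measureReal_congr hev, measureReal_def,
    hpair.measure_inter_preimage_eq_mul _ _ hASm hARm, ENNReal.toReal_mul, ← measureReal_def,
    ← measureReal_def]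
  have e1 := (hlawS.measureReal_eq (p := fun p => p ∈ AS) hASm).trans
    (hnet.hopS.real_coverage (sic_nonneg hα n) hgS)
  have e2 := (hlawR.measureReal_eq (p := fun p => p ∈ AR) hARm).trans
    ((hnet.hopR n).real_coverage (sic_nonneg hβ n) hgR)
  exact congrArg₂ (· * ·) e1 e2

end Network

end NOMA

open NOMA in
theorem corollary3 {C : ℕ} (hC : 0 < C) (net : Network C) (hnet : net.Valid)
    (h : Gains C) (hh : h.Valid) (Rbar : ℝ) (hR : 0 < Rbar)
    {Ω : Type*} [MeasurableSpace Ω] (μ : Measure Ω) [IsProbabilityMeasure μ]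
    (H : Ω → Gains C) (hH : net.IsNakagami H μ) :
    ∃ (α β : Fin C → ℝ) (g : ℝ),
      (∀ α' β' g', net.IsOptimalPower h α' β' g' ↔ α' = α ∧ β' = β ∧ g' = g) ∧
      0 < g ∧
      (∀ n, net.sidnrS net.powerS h α n = g ∧ net.sidnrR net.powerR h β n = g) ∧
      (∀ n, α n = net.alphaClosed h g n ∧ β n = net.betaClosed h g n) ∧
      (∃ gR : ℝ, 0 < gR ∧ ∑ n, net.betaClosed h gR n = net.budgetR h ∧
        g = min ((net.budgetS h / net.noiseS h + 1) ^ (1 / (C : ℝ)) - 1) gR ∧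
        ∀ hC2 : C = 2,
          let I₁ := net.noiseTermR h ⟨0, by omega⟩
          let I₂ := net.noiseTermR h ⟨1, by omega⟩
          gR = (√(4 * I₂ * net.budgetR h + (I₁ + I₂) ^ 2) - I₁ - I₂) / (2 * I₂)) ∧
      (∀ lam, net.IsOptimalTime h α β lam ↔ lam = 1 / 2) ∧
      (∀ n, net.userRate h α β (1 / 2) n = net.bandwidth / 2 * Real.logb 2 (1 + g)) ∧
      net.clusterRate h α β (1 / 2) = net.bandwidth / 2 * Real.logb 2 (1 + g) ∧
      (∀ n, net.coverage H μ Rbar α β (1 / 2) n = net.coverageClosed Rbar α β (1 / 2) n) ∧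
      IsLeast (Set.range (net.coverageClosed Rbar α β (1 / 2)))
        (net.clusterCoverage H μ Rbar α β (1 / 2)) := by
  have hgS := hnet.sum_alphaClosed_root hh hC
  obtain ⟨gR, hgR0, hgR⟩ := hnet.exists_sum_betaClosed hh hC (hnet.budgetR_pos hh)
  set gS := (net.budgetS h / net.noiseS h + 1) ^ (1 / (C : ℝ)) - 1
  have hg : 0 < min gS gR := lt_min hgS.1 hgR0
  have hs : ∀ n, net.sidnrS net.powerS h (net.alphaClosed h (min gS gR)) n = min gS gR ∧
      net.sidnrR net.powerR h (net.betaClosed h (min gS gR)) n = min gS gR := fun n =>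
    ⟨hnet.sidnrS_alphaClosed hh hg.le n, hnet.sidnrR_betaClosed hh hg.le n⟩
  obtain ⟨htime, hrate, hcluster⟩ := hnet.isOptimalTime_iff hC hg hs
  have hcov : ∀ n, net.coverage H μ Rbar (net.alphaClosed h (min gS gR))
      (net.betaClosed h (min gS gR)) (1 / 2) n = net.coverageClosed Rbar
      (net.alphaClosed h (min gS gR)) (net.betaClosed h (min gS gR)) (1 / 2) n := fun n =>
    hnet.coverage_eq_coverageClosed hH hR (hnet.alphaClosed_nonneg hh hg.le)
      (hnet.betaClosed_nonneg hh hg.le) (by norm_num) (by norm_num) n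
  refine ⟨net.alphaClosed h (min gS gR), net.betaClosed h (min gS gR), min gS gR,
    hnet.isOptimalPower_iff hh hC hgS.1.le hgR0.le hgS.2 hgR, hg, hs, fun n => ⟨rfl, rfl⟩,
    ⟨gR, hgR0, hgR, rfl, fun hC2 => hnet.two_users hh hC2 rfl rfl hgR0 hgR⟩, htime, hrate, hcluster,
    hcov, ?_⟩
  -- Nonemptiness and finiteness make the infimum an attained minimum; over an empty cluster it
  -- would be the default `0`.
  have : Nonempty (Fin C) := ⟨⟨0, hC⟩⟩
  rw [Network.clusterCoverage, ← funext hcov]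
  exact ⟨exists_eq_ciInf_of_finite, by
    rintro _ ⟨n, rfl⟩
    exact ciInf_le (Set.finite_range _).bddBelow n⟩
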